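/- Let $p\ge 1$ and consider the autoregression $x_n=\theta_1x_{n-1}+\dots+\theta_px_{n-p}+\varepsilon_n$, $n\ge 1$, with $x_0=x_{-1}=\dots=x_{1-p}=0$, where $\varepsilon_1,\varepsilon_2,\dots$ are i.i.d. with $\mathbf E\varepsilon_1=0$ and $0<\mathbf E\varepsilon_1^2=\sigma^2<\infty$, and $\theta=(\theta_1,\dots,\theta_p)'\in\mathbb R^p$. Put $X_n=(x_n,x_{n-1},\dots,x_{n-p+1})'$, $M_n=\sum_{k=1}^nX_{k-1}X_{k-1}'$ and, for $h>0$, $$\tau(h)=\inf\{n\ge 1:\ \operatorname{tr}M_n\ge h\sigma^2\},\qquad \inf\emptyset=+\infty .$$ Let $\mathcal A_p$ be the set of all $\theta\in\mathbb R^p$ such that (i) all complex roots of $z^p-\theta_1z^{p-1}-\dots-\theta_p$ lie inside or on the unit circle; (ii) those on the unit circle are simple; (iii) the linear system $$Y_j-\sum_{k=1}^{j-1}\theta_{j-k}Y_k-\sum_{k=1}^{p-j}\theta_{k+j}Y_k=\theta_j,\qquad 1\le j\le p-1,$$ has a unique solution $(Y_1,\dots,Y_{p-1})=(\kappa_1(\theta),\dots,\kappa_{p-1}(\theta))$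 (no condition if $p=1$). For $\theta\in\mathcal A_p$ let $L(\theta)$ be the symmetric $p\times p$ Toeplitz matrix with ones on the diagonal and entries $\kappa_{|i-j|}(\theta)$ for $i\ne j$. Then for every compact set $K\subset\mathcal A_p$ and every $\delta>0$, $$\lim_{h\to\infty}\ \sup_{\theta\in K}\ \mathbf P_\theta\left(\tau(h)=\infty\ \text{ or }\ \left\|\frac{M_{\tau(h)}}{h}-\frac{\sigma^2}{p}\,L(\theta)\right\|>\delta\right)=0,$$ where $\|\cdot\|$ is the Frobenius norm. That is, $M_{\tau(h)}/h$ converges in probability to $\frac{\sigma^2}{p}L(\theta)$ as $h\to\infty$, uniformly in $\theta\in K$. -/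

import Mathlib

open MeasureTheory ProbabilityTheory Filter Topology

attribute [local instance] Matrix.frobeniusNormedAddCommGroup

namespace SeqAR

/-- The `i`-th coordinate (counted from `1`) of a vector, and `0` outside the range. -/
def at1 {m : ℕ} (v : Fin m → ℝ) (i : ℕ) : ℝ :=
  if h : 1 ≤ i ∧ i ≤ m then v ⟨i - 1, by omega⟩ else 0

/-- The characteristic polynomial `z ^ p - θ_1 z ^ (p-1) - ... - θ_p`, over `ℂ`. -/
noncomputable def charPoly {p : ℕ} (θ : Fin p → ℝ) : Polynomial ℂ :=
  Polynomial.X ^ p -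
    ∑ l ∈ Finset.Icc 1 p, Polynomial.C ((at1 θ l : ℝ) : ℂ) * Polynomial.X ^ (p - l)

/-- All roots of the characteristic polynomial lie inside or on the unit circle, and those on the
unit circle are simple. -/
def IsUnstableSimple {p : ℕ} (θ : Fin p → ℝ) : Prop :=
  (∀ z : ℂ, (charPoly θ).IsRoot z → ‖z‖ ≤ 1) ∧
  (∀ z : ℂ, (charPoly θ).IsRoot z → ‖z‖ = 1 → (charPoly θ).rootMultiplicity z = 1)

/-- `Y = (Y_1, ..., Y_{p-1})` solves
`Y_j - ∑_{k=1}^{j-1} θ_{j-k} Y_k - ∑_{k=1}^{p-j} θ_{k+j} Y_k = θ_j`, for `1 ≤ j ≤ p-1`. -/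
def IsCorrSolution {p : ℕ} (θ : Fin p → ℝ) (Y : Fin (p - 1) → ℝ) : Prop :=
  ∀ j ∈ Finset.Icc 1 (p - 1),
    at1 Y j - ∑ k ∈ Finset.Icc 1 (j - 1), at1 θ (j - k) * at1 Y k
      - ∑ k ∈ Finset.Icc 1 (p - j), at1 θ (k + j) * at1 Y k = at1 θ j

open scoped Classical in
/-- The vector `(κ_1(θ), ..., κ_{p-1}(θ))`: the unique solution of the system, when there is one
(`0` otherwise). -/
noncomputable def kappa {p : ℕ} (θ : Fin p → ℝ) : Fin (p - 1) → ℝ :=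
  if h : ∃! Y : Fin (p - 1) → ℝ, IsCorrSolution θ Y then h.choose else 0

/-- The symmetric Toeplitz matrix `L(θ)` with ones on the diagonal and `κ_{|i-j|}(θ)` off it. -/
noncomputable def L {p : ℕ} (θ : Fin p → ℝ) : Matrix (Fin p) (Fin p) ℝ :=
  Matrix.of fun i j => if i = j then 1 else at1 (kappa θ) ((i : ℤ) - (j : ℤ)).natAbs

/-- The parameters with all roots inside or on the unit circle, those on it being simple, for
which the linear system has a unique solution, so that `L(θ)` is defined. -/
def admissible (p : ℕ) : Set (Fin p → ℝ) :=
  {θ | IsUnstableSimple θ ∧ ∃! Y : Fin (p - 1) → ℝ, IsCorrSolution θ Y}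

/-- The path of the autoregression `x_n = θ_1 x_{n-1} + ... + θ_p x_{n-p} + ε_n`, `n ≥ 1`, with
`x_0 = x_{-1} = ... = x_{1-p} = 0`; here `e n` is `ε_{n+1}`. Natural number subtraction sends
every nonpositive time to time `0`, where the path vanishes as it does at all those times. -/
noncomputable def path {p : ℕ} (θ : Fin p → ℝ) (e : ℕ → ℝ) : ℕ → ℝ
  | 0 => 0
  | n + 1 => ∑ l : Fin p, θ l * path θ e (n - (l : ℕ)) + e n
termination_by n => n
decreasing_by omega

/-- The state vector `X_n = (x_n, x_{n-1}, ..., x_{n-p+1})`. -/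
noncomputable def state {p : ℕ} (θ : Fin p → ℝ) (e : ℕ → ℝ) (n : ℕ) : Fin p → ℝ :=
  fun i => path θ e (n - (i : ℕ))

/-- The observed Fisher information matrix `M_n = ∑_{k=1}^n X_{k-1} X_{k-1}'`. -/
noncomputable def M {p : ℕ} (θ : Fin p → ℝ) (e : ℕ → ℝ) (n : ℕ) : Matrix (Fin p) (Fin p) ℝ :=
  ∑ k ∈ Finset.Icc 1 n, Matrix.vecMulVec (state θ e (k - 1)) (state θ e (k - 1))

/-- The stopping time `τ(h) = inf {n ≥ 1 : tr M_n ≥ h σ²}`, with `inf ∅ = ∞`. -/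
noncomputable def tau {p : ℕ} (θ : Fin p → ℝ) (e : ℕ → ℝ) (σ h : ℝ) : ℕ∞ :=
  sInf ((fun n : ℕ => (n : ℕ∞)) '' {n : ℕ | 1 ≤ n ∧ h * σ ^ 2 ≤ (M θ e n).trace})

end SeqAR

/-! The argument is pathwise, apart from two facts about the noise. Multiplying the recursion by
lagged values and summing shows that M_{s+1} is Toeplitz up to entries of the rank-one matrix X_s
X_s', and that its first row satisfies the Yule-Walker equations up to such entries and the noise
sums ∑ ε_k x_{k-j}. At the crossing time the trace overshoots hσ² by at most |X_s|². Condition (iii)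
makes the Yule-Walker system invertible, uniformly on K (`exists_corrOp_lower_bound`), so M/h is
close to (σ²/p) L(θ) as soon as these errors are small compared with h
(`exists_norm_sub_smul_L_le`).

Noise sums: switched off at the crossing, they are martingale transforms with energy below hσ², so
Chebyshev makes them negligible against h (`prob_abs_sum_mul_gt_le`).

Last state: by (i) and (ii) the impulse response is bounded, uniformly on K
(`exists_impulse_response_bound`). If all noise is small against √h, a value above √(γh) cannot
build up within m steps, so the m preceding states are all of order √(γh); for m large their squares
exceed hσ², although the trace is still below it (`abs_path_le_of_trace_lt`).

The trace dominates the sum of squared noise (`sum_sq_noise_le`), so τ(h) = O(h); the strong law for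
ε² gives this growth and the smallness of the largest noise term. That noise event does not involve
θ, and all constants depend on K only, hence the uniformity. -/

namespace SeqAR

/-! ### Coefficients of products of geometric series. -/

/-- The geometric series `∑ a ^ n z ^ n = 1 / (1 - a z)`. -/
noncomputable def geom (a : ℂ) : PowerSeries ℂ := PowerSeries.mk fun n => a ^ n

theorem one_sub_mul_geom (a : ℂ) :
    (1 - PowerSeries.C a * PowerSeries.X) * geom a = 1 := by
  ext n
  rw [sub_mul, one_mul, mul_assoc, map_sub, PowerSeries.coeff_C_mul]
  cases n with
  | zero => simp [geom]
  | succ n =>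
    rw [PowerSeries.coeff_succ_X_mul]
    simp [geom, PowerSeries.coeff_one, pow_succ']

/-- Partial fractions: (a - b)z = (1 - bz) - (1 - az). It removes one factor from a product at the
cost of dividing by a - b. -/
theorem sub_mul_X_mul_geom_mul_geom (a b : ℂ) :
    PowerSeries.C (a - b) * (PowerSeries.X * (geom a * geom b)) = geom a - geom b := by
  have ha := one_sub_mul_geom a
  have hb := one_sub_mul_geom b
  rw [map_sub]
  linear_combination (-geom b) * ha + geom a * hb

theorem norm_coeff_geom_mul_le {a : ℂ} {c B : ℝ} (hc : 0 < c) (ha : ‖a‖ ≤ 1 - c) (hB : 0 ≤ B)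
    {F : PowerSeries ℂ} (hF : ∀ n, ‖PowerSeries.coeff n F‖ ≤ B) (n : ℕ) :
    ‖PowerSeries.coeff n (geom a * F)‖ ≤ B / c := by
  have hr : 0 ≤ 1 - c := (norm_nonneg a).trans ha
  rw [PowerSeries.coeff_mul, Finset.Nat.sum_antidiagonal_eq_sum_range_succ_mk]
  calc _ ≤ ∑ k ∈ Finset.range (n + 1), (1 - c) ^ k * B := by
        refine (norm_sum_le _ _).trans (Finset.sum_le_sum fun k _ => ?_)
        rw [norm_mul]
        refine mul_le_mul ?_ (hF _) (norm_nonneg _) (by positivity)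
        simp only [geom, PowerSeries.coeff_mk, norm_pow]
        gcongr
    _ = (∑ k ∈ Finset.range (n + 1), (1 - c) ^ k) * B := by rw [Finset.sum_mul]
    _ ≤ c⁻¹ * B := by
        gcongr
        have h := mul_neg_geom_sum (1 - c) (n + 1)
        rw [sub_sub_cancel] at h
        rw [← one_div, le_div_iff₀ hc, mul_comm, h]
        linarith [pow_nonneg hr (n + 1)]
    _ = B / c := by rw [div_eq_mul_inv, mul_comm]

/-- Induction on the number of factors. A factor with ‖a i‖ ≤ 1 - c has absolutely summable
coefficients, and dropping it costs 1/c. If there is none, any two a's are c apart, and partial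
fractions reduce to two shorter products at cost 2/c. -/
theorem norm_coeff_prod_geom_le {ι : Type*} [DecidableEq ι] (a : ι → ℂ) {c : ℝ} (hc : 0 < c)
    (hc1 : c ≤ 1) (s : Finset ι) (ha : ∀ i ∈ s, ‖a i‖ ≤ 1)
    (hgap : ∀ i ∈ s, ∀ j ∈ s, i ≠ j → c ≤ ‖a i - a j‖ ∨ ‖a i‖ ≤ 1 - c) (n : ℕ) :
    ‖PowerSeries.coeff n (∏ i ∈ s, geom (a i))‖ ≤ (2 / c) ^ s.card := by
  have h2c : 1 ≤ 2 / c := by rw [le_div_iff₀ hc]; linarith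
  induction hk : s.card generalizing s n with
  | zero =>
    rw [Finset.card_eq_zero.1 hk]
    simp only [Finset.prod_empty, PowerSeries.coeff_one, pow_zero]
    split_ifs <;> simp
  | succ k ih =>
    have herase : ∀ i ∈ s, ∀ n,
        ‖PowerSeries.coeff n (∏ j ∈ s.erase i, geom (a j))‖ ≤ (2 / c) ^ k := fun i hi n =>
      ih (s.erase i) (fun j hj => ha j (Finset.mem_of_mem_erase hj))
        (fun j hj l hl => hgap j (Finset.mem_of_mem_erase hj) l (Finset.mem_of_mem_erase hl)) n
        (by rw [Finset.card_erase_of_mem hi, hk]; rfl)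
    have hpow : (0 : ℝ) ≤ (2 / c) ^ k := by positivity
    by_cases hsmall : ∃ i ∈ s, ‖a i‖ ≤ 1 - c
    · obtain ⟨i, hi, hai⟩ := hsmall
      rw [← Finset.mul_prod_erase s _ hi]
      refine (norm_coeff_geom_mul_le hc hai hpow (herase i hi) n).trans ?_
      rw [pow_succ, div_eq_mul_inv, div_eq_mul_inv]
      gcongr
      linarith [inv_pos.2 hc]
    push Not at hsmall
    obtain ⟨i, hi⟩ : s.Nonempty := Finset.card_pos.1 (by omega)
    by_cases hk0 : k = 0
    · subst hk0
      obtain ⟨i, rfl⟩ := Finset.card_eq_one.1 hk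
      simp only [Finset.prod_singleton, geom, PowerSeries.coeff_mk, norm_pow]
      refine (pow_le_one₀ (norm_nonneg _) (ha i (by simp))).trans ?_
      simpa using h2c
    obtain ⟨j, hj⟩ : (s.erase i).Nonempty :=
      Finset.card_pos.1 (by rw [Finset.card_erase_of_mem hi]; omega)
    obtain ⟨hji, hjs⟩ := Finset.mem_erase.1 hj
    have hd : c ≤ ‖a i - a j‖ :=
      (hgap i hi j hjs hji.symm).resolve_right (not_le.2 (hsmall i hi))
    set R := ∏ l ∈ (s.erase i).erase j, geom (a l) with hR
    have e1 : ∏ l ∈ s.erase i, geom (a l) = geom (a j) * R :=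
      (Finset.mul_prod_erase _ _ hj).symm
    have e2 : ∏ l ∈ s.erase j, geom (a l) = geom (a i) * R := by
      rw [hR, Finset.erase_right_comm]
      exact (Finset.mul_prod_erase _ _ (Finset.mem_erase.2 ⟨hji.symm, hi⟩)).symm
    have e3 : PowerSeries.C (a i - a j) * (PowerSeries.X * ∏ l ∈ s, geom (a l)) =
        (∏ l ∈ s.erase j, geom (a l)) - ∏ l ∈ s.erase i, geom (a l) := by
      rw [← Finset.mul_prod_erase s _ hi, e1, e2, ← sub_mul, ← sub_mul_X_mul_geom_mul_geom]
      ring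
    have e4 := congrArg norm (congrArg (PowerSeries.coeff (n + 1)) e3)
    rw [PowerSeries.coeff_C_mul, PowerSeries.coeff_succ_X_mul, norm_mul, map_sub] at e4
    have e5 : c * ‖PowerSeries.coeff n (∏ l ∈ s, geom (a l))‖ ≤ 2 * (2 / c) ^ k :=
      calc _ ≤ ‖a i - a j‖ * ‖PowerSeries.coeff n (∏ l ∈ s, geom (a l))‖ := by gcongr
        _ ≤ _ := by
          rw [e4]
          refine (norm_sub_le _ _).trans ?_
          linarith [herase i hi (n + 1), herase j hjs (n + 1)]
    rw [pow_succ, ← mul_div_assoc, le_div_iff₀ hc]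
    linarith

/-! ### The characteristic polynomial, its reversal and its roots. -/

theorem at1_succ {m : ℕ} (v : Fin m → ℝ) (i : Fin m) : at1 v (i + 1) = v i := by
  have := i.2
  simp [at1]

theorem sum_Icc_one_eq_sum_fin {A : Type*} [AddCommMonoid A] (p : ℕ) (f : ℕ → A) :
    ∑ l ∈ Finset.Icc 1 p, f l = ∑ l : Fin p, f (l + 1) := by
  rw [Fin.sum_univ_eq_sum_range (fun l => f (l + 1)), Finset.range_eq_Ico,
    Finset.sum_Ico_add' f 0 p 1]
  rfl

theorem eval_charPoly {p : ℕ} (θ : Fin p → ℝ) (z : ℂ) :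
    (charPoly θ).eval z = z ^ p - ∑ l : Fin p, (θ l : ℂ) * z ^ (p - (l + 1)) := by
  simp [charPoly, sum_Icc_one_eq_sum_fin, Polynomial.eval_finsetSum, at1_succ]

theorem charPoly_monic_natDegree {p : ℕ} (θ : Fin p → ℝ) :
    (charPoly θ).Monic ∧ (charPoly θ).natDegree = p := by
  have h : (∑ l ∈ Finset.Icc 1 p, Polynomial.C ((at1 θ l : ℝ) : ℂ) *
      (Polynomial.X : Polynomial ℂ) ^ (p - l)).degree < (p : WithBot ℕ) := by
    refine (Polynomial.degree_sum_le _ _).trans_lt ?_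
    refine (Finset.sup_lt_iff (WithBot.bot_lt_coe p)).2 ?_
    intro l hl
    refine (Polynomial.degree_C_mul_X_pow_le _ _).trans_lt ?_
    have := Finset.mem_Icc.1 hl
    have hlt : p - l < p := by omega
    exact WithBot.coe_lt_coe.2 hlt
  refine ⟨Polynomial.monic_X_pow_sub h, Polynomial.natDegree_eq_of_degree_eq_some ?_⟩
  rw [charPoly, Polynomial.degree_sub_eq_left_of_degree_lt] <;> rw [Polynomial.degree_X_pow]
  exact h

theorem exists_charPoly_eq_prod {p : ℕ} (θ : Fin p → ℝ) :
    ∃ a : Fin p → ℂ, charPoly θ = ∏ i, (Polynomial.X - Polynomial.C (a i)) := by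
  obtain ⟨hm, hd⟩ := charPoly_monic_natDegree θ
  have hs := IsAlgClosed.splits (charPoly θ)
  obtain ⟨l, hl⟩ := Quot.exists_rep (charPoly θ).roots
  have hcard : l.length = p := by
    rw [← hd, hs.natDegree_eq_card_roots, ← hl]; rfl
  have h := hs.eq_prod_roots_of_monic hm
  rw [← hl] at h
  refine ⟨fun i => l.get (i.cast hcard.symm), h.trans ?_⟩
  have e : ((Multiset.map (fun a => Polynomial.X - Polynomial.C a) (l : Multiset ℂ)).prod) =
      ∏ i : Fin l.length, (Polynomial.X - Polynomial.C (l.get i)) := by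
    rw [Multiset.map_coe, Multiset.prod_coe, ← List.prod_ofFn]
    conv_lhs => rw [← List.ofFn_get l, List.map_ofFn]
    rfl
  refine e.trans ?_
  exact (Fintype.prod_equiv (finCongr hcard.symm) _ _ fun i => rfl).symm

/-- The power series `1 - θ_1 z - ... - θ_p z ^ p`. -/
noncomputable def arSeries {p : ℕ} (θ : Fin p → ℝ) : PowerSeries ℂ :=
  1 - ∑ l : Fin p, PowerSeries.C (θ l : ℂ) * PowerSeries.X ^ ((l : ℕ) + 1)

/-- The series is the reversed polynomial w^p χ(1/w); both sides are polynomials that agree at every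
w ≠ 0. -/
theorem arSeries_eq_prod {p : ℕ} {θ : Fin p → ℝ} {a : Fin p → ℂ}
    (h : charPoly θ = ∏ i, (Polynomial.X - Polynomial.C (a i))) :
    arSeries θ = ∏ i, (1 - PowerSeries.C (a i) * PowerSeries.X) := by
  have key : (1 - ∑ l : Fin p, Polynomial.C (θ l : ℂ) * Polynomial.X ^ ((l : ℕ) + 1) :
      Polynomial ℂ) = ∏ i, (1 - Polynomial.C (a i) * Polynomial.X) := by
    refine Polynomial.eq_of_infinite_eval_eq _ _ ?_
    refine (Set.Infinite.mono (s := {0}ᶜ) ?_ (Set.finite_singleton (0 : ℂ)).infinite_compl)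
    intro w hw
    have hw : w ≠ 0 := hw
    have h1 := congrArg (Polynomial.eval w⁻¹) h
    rw [eval_charPoly, Polynomial.eval_prod] at h1
    have h2 := congrArg (fun x => w ^ p * x) h1
    simp only [mul_sub, Finset.mul_sum, Polynomial.eval_sub, Polynomial.eval_X,
      Polynomial.eval_C] at h2
    have h3 : w ^ p * ∏ i, (w⁻¹ - a i) = ∏ i, (1 - a i * w) := by
      have : w ^ p = ∏ _i : Fin p, w := by simp
      rw [this, ← Finset.prod_mul_distrib]
      refine Finset.prod_congr rfl fun i _ => ?_
      field_simp
    rw [h3] at h2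
    simp only [Set.mem_ofPred_eq, Polynomial.eval_sub, Polynomial.eval_one, Polynomial.eval_prod,
      Polynomial.eval_finsetSum, Polynomial.eval_mul, Polynomial.eval_C, Polynomial.eval_X,
      Polynomial.eval_pow]
    rw [← h2]
    congr 1
    · rw [← mul_pow, mul_inv_cancel₀ hw, one_pow]
    · refine Finset.sum_congr rfl fun l _ => ?_
      have e : w ^ p = w ^ ((l : ℕ) + 1) * w ^ (p - (l + 1)) := by
        rw [← pow_add]; congr 1; omega
      rw [e, inv_pow]
      field_simp
  have := congrArg (Polynomial.coeToPowerSeries.ringHom (R := ℂ)) key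
  simpa [arSeries, map_sub, map_sum, map_prod, map_mul, map_pow] using this

theorem not_isUnstableSimple_of_double {p : ℕ} {θ : Fin p → ℝ} {a : Fin p → ℂ}
    (h : charPoly θ = ∏ i, (Polynomial.X - Polynomial.C (a i))) {i j : Fin p} (hij : i ≠ j)
    (hai : ‖a i‖ = 1) (haij : a i = a j) : ¬ IsUnstableSimple θ := by
  intro hθ
  have hdvd : (Polynomial.X - Polynomial.C (a i)) ^ 2 ∣ charPoly θ := by
    rw [h, ← Finset.mul_prod_erase _ _ (Finset.mem_univ i),
      ← Finset.mul_prod_erase _ _ (Finset.mem_erase.2 ⟨hij.symm, Finset.mem_univ j⟩), ← haij,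
      ← mul_assoc, ← sq]
    exact dvd_mul_right _ _
  have h2 := (Polynomial.le_rootMultiplicity_iff (charPoly_monic_natDegree θ).1.ne_zero).2 hdvd
  have hroot : (charPoly θ).IsRoot (a i) :=
    Polynomial.dvd_iff_isRoot.1 ((dvd_pow_self _ two_ne_zero).trans hdvd)
  have := hθ.2 _ hroot hai
  omega

/-- The sum ‖a i - a j‖ + (1 - ‖a i‖) is continuous on the compact set of pairs (ordered root tuple,
parameter), and vanishes only at a multiple root on the unit circle. Working with tuples avoids
continuity of the roots in θ. -/
theorem exists_root_gap {p : ℕ} {K : Set (Fin p → ℝ)} (hK : IsCompact K)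
    (hKu : ∀ θ ∈ K, IsUnstableSimple θ) :
    ∃ c : ℝ, 0 < c ∧ c ≤ 1 ∧ ∀ θ ∈ K, ∀ a : Fin p → ℂ,
      charPoly θ = ∏ i, (Polynomial.X - Polynomial.C (a i)) →
      ∀ i j, i ≠ j → c ≤ ‖a i - a j‖ ∨ ‖a i‖ ≤ 1 - c := by
  have hdisc : ∀ θ ∈ K, ∀ a : Fin p → ℂ,
      charPoly θ = ∏ i, (Polynomial.X - Polynomial.C (a i)) → ∀ i, ‖a i‖ ≤ 1 := by
    intro θ hθ a h i
    refine (hKu θ hθ).1 _ ?_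
    rw [h, Polynomial.IsRoot.def, Polynomial.eval_prod]
    exact Finset.prod_eq_zero (Finset.mem_univ i) (by simp)
  set S : Set ((Fin p → ℂ) × (Fin p → ℝ)) := (Metric.closedBall 0 1 ×ˢ K) ∩
    {x | charPoly x.2 = ∏ i, (Polynomial.X - Polynomial.C (x.1 i))} with hS
  have hSc : IsCompact S := by
    refine ((isCompact_closedBall _ _).prod hK).inter_right ?_
    -- Equality of polynomials is tested at each z, which exhibits the set as an intersection of
    -- closed sets.
    have : {x : (Fin p → ℂ) × (Fin p → ℝ) |
        charPoly x.2 = ∏ i, (Polynomial.X - Polynomial.C (x.1 i))} =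
        ⋂ z : ℂ, {x | z ^ p - ∑ l : Fin p, (x.2 l : ℂ) * z ^ (p - (l + 1)) =
          ∏ i, (z - x.1 i)} := by
      ext x
      simp only [Set.mem_ofPred_eq, Set.mem_iInter, ← eval_charPoly]
      refine ⟨fun h z => by rw [h]; simp [Polynomial.eval_prod], fun h => ?_⟩
      refine Polynomial.funext fun z => ?_
      rw [h z]; simp [Polynomial.eval_prod]
    rw [this]
    refine isClosed_iInter fun z => isClosed_eq ?_ ?_ <;> fun_prop
  have hpair : ∀ i j : Fin p, i ≠ j → ∀ᶠ c in 𝓝[>] (0 : ℝ), ∀ x ∈ S,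
      2 * c ≤ ‖x.1 i - x.1 j‖ + (1 - ‖x.1 i‖) := by
    intro i j hij
    obtain ⟨c, hc, hcS⟩ := hSc.exists_forall_le'
      (f := fun x => ‖x.1 i - x.1 j‖ + (1 - ‖x.1 i‖)) (by fun_prop) (a := 0) (by
        rintro x ⟨⟨h1, h2⟩, h3⟩
        have hle := hdisc x.2 h2 x.1 h3 i
        by_contra hcon
        have h0 := norm_nonneg (x.1 i - x.1 j)
        refine not_isUnstableSimple_of_double h3 hij (by linarith) ?_ (hKu _ h2)
        exact sub_eq_zero.1 (norm_eq_zero.1 (by linarith)))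
    filter_upwards [Ioo_mem_nhdsGT (half_pos hc)] with d hd x hx
    linarith [hcS x hx, hd.2]
  have hall : ∀ᶠ c in 𝓝[>] (0 : ℝ), ∀ i j : Fin p, i ≠ j → ∀ x ∈ S,
      2 * c ≤ ‖x.1 i - x.1 j‖ + (1 - ‖x.1 i‖) := by
    rw [eventually_all]; intro i
    rw [eventually_all]; intro j
    by_cases hij : i = j
    · simp [hij]
    · simpa [hij] using hpair i j hij
  obtain ⟨c, hc, hc0, hc1⟩ := (hall.and (Ioo_mem_nhdsGT (zero_lt_one' ℝ))).exists
  refine ⟨c, hc0, hc1.le, fun θ hθ a h i j hij => ?_⟩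
  have := hc i j hij (a, θ) ⟨⟨by
    rw [mem_closedBall_zero_iff, pi_norm_le_iff_of_nonneg zero_le_one]
    exact hdisc θ hθ a h, hθ⟩, h⟩
  simp only at this
  by_contra! hcon
  linarith [hcon.1, hcon.2]

theorem exists_impulse_response_bound {p : ℕ} {K : Set (Fin p → ℝ)} (hK : IsCompact K)
    (hKu : ∀ θ ∈ K, IsUnstableSimple θ) :
    ∃ B : ℝ, 0 < B ∧ ∀ θ ∈ K, ∃ Ψ : PowerSeries ℂ, arSeries θ * Ψ = 1 ∧
      ∀ n, ‖PowerSeries.coeff n Ψ‖ ≤ B := by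
  obtain ⟨c, hc, hc1, hgap⟩ := exists_root_gap hK hKu
  refine ⟨(2 / c) ^ p, by positivity, fun θ hθ => ?_⟩
  obtain ⟨a, ha⟩ := exists_charPoly_eq_prod θ
  refine ⟨∏ i, geom (a i), ?_, fun n => ?_⟩
  · rw [arSeries_eq_prod ha, ← Finset.prod_mul_distrib]
    exact Finset.prod_eq_one fun i _ => one_sub_mul_geom _
  · have h := norm_coeff_prod_geom_le a hc hc1 Finset.univ (fun i _ => ?_)
      (fun i _ j _ hij => hgap θ hθ a ha i j hij) n
    · simpa using h
    · refine (hKu θ hθ).1 _ ?_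
      rw [ha, Polynomial.IsRoot.def, Polynomial.eval_prod]
      exact Finset.prod_eq_zero (Finset.mem_univ i) (by simp)

/-! ### Paths driven by an arbitrary deterministic noise. -/

section Deterministic

variable {p : ℕ}

theorem path_zero (θ : Fin p → ℝ) (e : ℕ → ℝ) : path θ e 0 = 0 := by rw [path]

theorem path_succ (θ : Fin p → ℝ) (e : ℕ → ℝ) (n : ℕ) :
    path θ e (n + 1) = ∑ l : Fin p, θ l * path θ e (n - (l : ℕ)) + e n := by rw [path]

theorem path_unique {θ : Fin p → ℝ} {e : ℕ → ℝ} {z : ℕ → ℝ} (h0 : z 0 = 0)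
    (hz : ∀ n, z (n + 1) = ∑ l : Fin p, θ l * z (n - (l : ℕ)) + e n) (n : ℕ) :
    z n = path θ e n := by
  induction n using Nat.strong_induction_on with
  | _ n ih =>
    cases n with
    | zero => rw [h0, path_zero]
    | succ n =>
      rw [hz, path_succ]
      congr 1
      exact Finset.sum_congr rfl fun l _ => by rw [ih _ (by omega)]

theorem arSeries_mul_mk_path (θ : Fin p → ℝ) (e : ℕ → ℝ) :
    arSeries θ * PowerSeries.mk (fun n => (path θ e n : ℂ)) =
      PowerSeries.X * PowerSeries.mk (fun n => (e n : ℂ)) := by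
  ext n
  rw [arSeries, sub_mul, one_mul, map_sub, Finset.sum_mul, map_sum]
  cases n with
  | zero =>
    simp [path_zero, mul_assoc]
  | succ n =>
    rw [PowerSeries.coeff_succ_X_mul]
    have : ∀ l : Fin p, PowerSeries.coeff (n + 1) (PowerSeries.C (θ l : ℂ) *
        PowerSeries.X ^ ((l : ℕ) + 1) * PowerSeries.mk (fun n => (path θ e n : ℂ))) =
        ((θ l * path θ e (n - (l : ℕ)) : ℝ) : ℂ) := by
      intro l
      rw [mul_assoc, PowerSeries.coeff_C_mul, PowerSeries.coeff_X_pow_mul']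
      split_ifs with h
      · rw [Nat.add_sub_add_right]; simp
      -- Here l > n: truncated subtraction reads time 0, where the path vanishes, matching the
      -- missing coefficient.
      · rw [show n - (l : ℕ) = 0 by omega, path_zero]; simp
    simp only [this, PowerSeries.coeff_mk, path_succ]
    push_cast
    ring

/-- Ψ is the impulse response, and the path is its convolution with the noise, delayed by one step.
-/
theorem abs_path_le {θ : Fin p → ℝ} {Ψ : PowerSeries ℂ} {B : ℝ} (hΨ : arSeries θ * Ψ = 1)
    (hB : ∀ n, ‖PowerSeries.coeff n Ψ‖ ≤ B) (e : ℕ → ℝ) (n : ℕ) :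
    |path θ e n| ≤ B * ∑ m ∈ Finset.range n, |e m| := by
  have h1 : PowerSeries.mk (fun n => (path θ e n : ℂ)) =
      PowerSeries.X * (PowerSeries.mk (fun n => (e n : ℂ)) * Ψ) := by
    linear_combination (- PowerSeries.mk (fun n => (path θ e n : ℂ))) * hΨ
      + Ψ * arSeries_mul_mk_path θ e
  cases n with
  | zero => simp [path_zero]
  | succ n =>
    have h2 := congrArg (PowerSeries.coeff (n + 1)) h1
    rw [PowerSeries.coeff_mk, PowerSeries.coeff_succ_X_mul, PowerSeries.coeff_mul,
      Finset.Nat.sum_antidiagonal_eq_sum_range_succ_mk] at h2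
    rw [← Real.norm_eq_abs, ← Complex.norm_real, h2, Finset.mul_sum]
    refine (norm_sum_le _ _).trans (Finset.sum_le_sum fun k _ => ?_)
    rw [norm_mul, PowerSeries.coeff_mk, Complex.norm_real, Real.norm_eq_abs, mul_comm]
    exact mul_le_mul_of_nonneg_right (hB _) (abs_nonneg _)

/-- The path is controlled by an earlier state and the noise since then. -/
theorem abs_path_le_of_state {θ : Fin p → ℝ} {Ψ : PowerSeries ℂ} {B T : ℝ}
    (hΨ : arSeries θ * Ψ = 1) (hB : ∀ n, ‖PowerSeries.coeff n Ψ‖ ≤ B)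
    (hT : ∀ l, |θ l| ≤ T) (hT0 : 0 ≤ T) (e : ℕ → ℝ) {s n : ℕ} (hsn : s < n) :
    |path θ e n| ≤ B * (∑ m ∈ Finset.Ico s n, |e m| + p * (p * T * ‖state θ e s‖)) := by
  have hB0 : 0 ≤ B := (norm_nonneg _).trans (hB 0)
  set x := path θ e with hx
  -- Restart at time s: z forgets the past and is again an autoregressive path, driven by the noise
  -- plus the terms u in which the recursion still reads times up to s.
  set z : ℕ → ℝ := fun m => if m ≤ s then 0 else x m with hz
  set u : ℕ → ℝ := fun m => ∑ l : Fin p, if m - (l : ℕ) ≤ s then θ l * x (m - (l : ℕ)) else 0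
    with hu
  set f : ℕ → ℝ := fun m => if m < s then 0 else e m + u m with hf
  have hzf : ∀ n, z n = path θ f n := by
    refine path_unique (by simp [hz]) fun m => ?_
    simp only [hz, hf, hu]
    by_cases hms : m < s
    · rw [if_pos (by omega), if_pos hms]
      symm
      rw [add_zero]
      exact Finset.sum_eq_zero fun l _ => by rw [if_pos (by omega), mul_zero]
    · rw [if_neg (by omega), if_neg hms, hx, path_succ, add_left_comm, ← Finset.sum_add_distrib,
        add_comm]
      congr 1
      refine Finset.sum_congr rfl fun l _ => ?_
      split_ifs <;> simp
  -- Lags are below p, so the forgotten past is felt during p steps only.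
  have hub : ∀ m, s ≤ m → |u m| ≤ if m < s + p then p * T * ‖state θ e s‖ else 0 := by
    intro m hm
    split_ifs with hmp
    · refine (Finset.abs_sum_le_sum_abs _ _).trans ?_
      calc _ ≤ ∑ _l : Fin p, T * ‖state θ e s‖ := by
            refine Finset.sum_le_sum fun l _ => ?_
            split_ifs with h
            · rw [abs_mul]
              refine mul_le_mul (hT l) ?_ (abs_nonneg _) hT0
              have h1 := norm_le_pi_norm (state θ e s) ⟨s - (m - l), by omega⟩
              simp only [state, Real.norm_eq_abs] at h1
              rwa [show s - (s - (m - (l : ℕ))) = m - l by omega] at h1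
            · rw [abs_zero]; positivity
        _ = _ := by simp [mul_assoc]
    · rw [abs_nonpos_iff]
      exact Finset.sum_eq_zero fun l _ => if_neg (by omega)
  have h1 : x n = path θ f n := by rw [← hzf]; simp [hz, hsn]
  rw [h1]
  refine (abs_path_le hΨ hB f n).trans (mul_le_mul_of_nonneg_left ?_ hB0)
  rw [Finset.range_eq_Ico, ← Finset.sum_Ico_consecutive _ (Nat.zero_le s) hsn.le,
    Finset.sum_eq_zero (fun m hm => ?_), zero_add]
  swap
  · simp [hf, (Finset.mem_Ico.1 hm).2]
  calc _ ≤ ∑ m ∈ Finset.Ico s n, (|e m| + if m < s + p then p * T * ‖state θ e s‖ else 0) := by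
        refine Finset.sum_le_sum fun m hm => ?_
        have hm := (Finset.mem_Ico.1 hm).1
        simp only [hf, not_lt.2 hm, if_false]
        exact (abs_add_le _ _).trans (by linarith [hub m hm])
    _ ≤ _ := by
        rw [Finset.sum_add_distrib, ← Finset.sum_filter, Finset.sum_const, nsmul_eq_mul]
        gcongr
        calc _ ≤ (Finset.Ico s (s + p)).card := Finset.card_le_card fun m hm => by
              simp only [Finset.mem_filter, Finset.mem_Ico] at hm ⊢; omega
          _ = p := by simp

theorem M_apply (θ : Fin p → ℝ) (e : ℕ → ℝ) (n : ℕ) (i j : Fin p) :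
    M θ e n i j = ∑ m ∈ Finset.range n, state θ e m i * state θ e m j := by
  rw [M, Matrix.sum_apply, Finset.range_eq_Ico,
    Finset.sum_Ico_eq_sum_range _ 0, ← Finset.Ico_succ_right_eq_Icc, Finset.sum_Ico_eq_sum_range]
  refine Finset.sum_congr (by simp) fun m _ => ?_
  rw [Matrix.vecMulVec_apply, Nat.add_sub_cancel_left, zero_add]

theorem trace_M (θ : Fin p → ℝ) (e : ℕ → ℝ) (n : ℕ) :
    (M θ e n).trace = ∑ m ∈ Finset.range n, ∑ i, state θ e m i ^ 2 := by
  rw [Finset.sum_comm]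
  simp only [Matrix.trace, Matrix.diag_apply, M_apply, sq]

theorem trace_M_mono (θ : Fin p → ℝ) (e : ℕ → ℝ) : Monotone fun n => (M θ e n).trace := by
  intro m n hmn
  simp only [trace_M]
  exact Finset.sum_le_sum_of_subset_of_nonneg (Finset.range_mono hmn)
    fun _ _ _ => Finset.sum_nonneg fun _ _ => sq_nonneg _

/-- Each noise term is x_{i+1} - θ·X_i, a combination of two successive states; Cauchy-Schwarz does
the rest. This is what bounds the stopping time. -/
theorem sum_sq_noise_le (hp : 1 ≤ p) {θ : Fin p → ℝ} {T : ℝ} (hT : ∀ l, |θ l| ≤ T)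
    (e : ℕ → ℝ) (N : ℕ) :
    ∑ i ∈ Finset.range N, e i ^ 2 ≤ (2 + 2 * (p * T ^ 2)) * (M θ e (N + 1)).trace := by
  have hθ : ∑ l, θ l ^ 2 ≤ p * T ^ 2 := by
    calc _ ≤ ∑ _l : Fin p, T ^ 2 := Finset.sum_le_sum fun l _ => sq_le_sq' (by
            linarith [neg_abs_le (θ l), hT l]) ((le_abs_self _).trans (hT l))
      _ = _ := by simp
  have hterm : ∀ i, e i ^ 2 ≤ 2 * ∑ l, state θ e (i + 1) l ^ 2 +
      2 * (p * T ^ 2) * ∑ l, state θ e i l ^ 2 := by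
    intro i
    have h1 : e i = path θ e (i + 1) - ∑ l, θ l * state θ e i l := by
      rw [path_succ]; simp [state]
    have h2 : path θ e (i + 1) ^ 2 ≤ ∑ l, state θ e (i + 1) l ^ 2 :=
      Finset.single_le_sum (f := fun l => state θ e (i + 1) l ^ 2) (fun _ _ => sq_nonneg _)
        (Finset.mem_univ (⟨0, hp⟩ : Fin p))
    have h3 : (∑ l, θ l * state θ e i l) ^ 2 ≤ (p * T ^ 2) * ∑ l, state θ e i l ^ 2 :=
      (Finset.sum_mul_sq_le_sq_mul_sq _ _ _).trans (mul_le_mul_of_nonneg_right hθ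
        (Finset.sum_nonneg fun _ _ => sq_nonneg _))
    rw [h1]
    nlinarith [sq_nonneg (path θ e (i + 1) + ∑ l, θ l * state θ e i l)]
  have hs : ∀ i, 0 ≤ ∑ l, state θ e i l ^ 2 := fun i => Finset.sum_nonneg fun _ _ => sq_nonneg _
  have h1 : ∑ i ∈ Finset.range N, ∑ l, state θ e (i + 1) l ^ 2 ≤ (M θ e (N + 1)).trace := by
    rw [trace_M, Finset.sum_range_succ']
    linarith [hs 0]
  have h2 : ∑ i ∈ Finset.range N, ∑ l, state θ e i l ^ 2 ≤ (M θ e (N + 1)).trace := by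
    rw [trace_M, Finset.sum_range_succ]
    linarith [hs N]
  refine (Finset.sum_le_sum fun i _ => hterm i).trans ?_
  rw [Finset.sum_add_distrib, ← Finset.mul_sum, ← Finset.mul_sum, add_mul]
  gcongr

theorem state_zero (θ : Fin p → ℝ) (e : ℕ → ℝ) : state θ e 0 = 0 := by
  funext i; simp [state, path_zero]

theorem norm_state_sq_le (θ : Fin p → ℝ) (e : ℕ → ℝ) (n : ℕ) :
    ‖state θ e n‖ ^ 2 ≤ ∑ i, state θ e n i ^ 2 := by
  have h : ‖state θ e n‖ ≤ √(∑ i, state θ e n i ^ 2) := by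
    refine (pi_norm_le_iff_of_nonneg (Real.sqrt_nonneg _)).2 fun i => ?_
    refine Real.le_sqrt_of_sq_le ?_
    rw [Real.norm_eq_abs, sq_abs]
    exact Finset.single_le_sum (f := fun i => state θ e n i ^ 2) (fun _ _ => sq_nonneg _)
      (Finset.mem_univ i)
  calc _ ≤ √(∑ i, state θ e n i ^ 2) ^ 2 := by gcongr
    _ = _ := Real.sq_sqrt (Finset.sum_nonneg fun _ _ => sq_nonneg _)

/-- A large value of the path forces many large states before it, hence a large trace. -/
theorem abs_path_le_of_trace_lt {θ : Fin p → ℝ} {Ψ : PowerSeries ℂ} {B T G R A η : ℝ}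
    (hΨ : arSeries θ * Ψ = 1) (hB : ∀ n, ‖PowerSeries.coeff n Ψ‖ ≤ B)
    (hT : ∀ l, |θ l| ≤ T) (hT0 : 0 ≤ T) (hG : 0 < G) (hBG : B * (p * (p * T)) ≤ G) (hR : 0 < R)
    {e : ℕ → ℝ} {s m : ℕ} (hs : (M θ e s).trace < A) (hη : ∀ i < s, |e i| ≤ η)
    (hmη : B * (m * η) ≤ R / 2) (hmA : A ≤ m * (R / (2 * G)) ^ 2) {t : ℕ} (hts : t ≤ s) :
    |path θ e t| ≤ R := by
  by_contra! hcon
  have hB0 : 0 ≤ B := (norm_nonneg _).trans (hB 0)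
  have ht : 0 < t := by
    rcases Nat.eq_zero_or_pos t with rfl | h
    · rw [path_zero, abs_zero] at hcon; linarith
    · exact h
  have hη0 : 0 ≤ η := (abs_nonneg _).trans (hη 0 (by omega))
  -- Noise over at most m steps contributes at most R/2, so the state at u must account for the
  -- other half.
  have hbig : ∀ u < t, t ≤ u + m → R / (2 * G) < ‖state θ e u‖ := by
    intro u hut hum
    have h1 := abs_path_le_of_state hΨ hB hT hT0 e hut
    have h2 : ∑ i ∈ Finset.Ico u t, |e i| ≤ m * η := by
      refine (Finset.sum_le_card_nsmul _ _ η fun i hi =>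
        hη i ((Finset.mem_Ico.1 hi).2.trans_le hts)).trans ?_
      rw [nsmul_eq_mul, Nat.card_Ico]
      gcongr
      omega
    have h3 : |path θ e t| ≤ R / 2 + G * ‖state θ e u‖ := by
      calc _ ≤ _ := h1
        _ ≤ B * (m * η + p * (p * T * ‖state θ e u‖)) := by gcongr
        _ = B * (m * η) + B * (p * (p * T)) * ‖state θ e u‖ := by ring
        _ ≤ _ := by gcongr
    rw [div_lt_iff₀ (by positivity)]
    linarith
  -- The state at time 0 is zero, hence not large, so the window of m steps does not reach back to
  -- it.
  have hmt : m < t := by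
    by_contra! h
    have := hbig 0 ht (by omega)
    rw [state_zero, norm_zero] at this
    exact absurd this (not_lt.2 (by positivity))
  have h4 : (m : ℝ) * (R / (2 * G)) ^ 2 ≤ (M θ e s).trace := by
    rw [trace_M]
    calc (m : ℝ) * (R / (2 * G)) ^ 2
        = (Finset.Ico (t - m) t).card • (R / (2 * G)) ^ 2 := by
          rw [Nat.card_Ico, nsmul_eq_mul, Nat.sub_sub_self hmt.le]
      _ ≤ ∑ u ∈ Finset.Ico (t - m) t, ∑ i, state θ e u i ^ 2 := by
          refine Finset.card_nsmul_le_sum _ _ _ fun u hu => ?_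
          rw [Finset.mem_Ico] at hu
          refine le_trans ?_ (norm_state_sq_le θ e u)
          have := hbig u hu.2 (by omega)
          gcongr
      _ ≤ _ := by
          refine Finset.sum_le_sum_of_subset_of_nonneg (fun u hu => ?_)
            fun _ _ _ => Finset.sum_nonneg fun _ _ => sq_nonneg _
          rw [Finset.mem_Ico] at hu
          exact Finset.mem_range.2 (by omega)
  linarith

/-! ### The Yule-Walker system and its stability. -/

theorem at1_sub {m : ℕ} (v w : Fin m → ℝ) (i : ℕ) : at1 (v - w) i = at1 v i - at1 w i := by
  unfold at1; split_ifs <;> simp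

theorem at1_smul {m : ℕ} (c : ℝ) (v : Fin m → ℝ) (i : ℕ) : at1 (c • v) i = c * at1 v i := by
  unfold at1; split_ifs <;> simp

@[fun_prop]
theorem continuous_at1 {m : ℕ} (i : ℕ) : Continuous fun v : Fin m → ℝ => at1 v i := by
  unfold at1; split_ifs <;> fun_prop

theorem abs_at1_le {m : ℕ} {v : Fin m → ℝ} {T : ℝ} (hT0 : 0 ≤ T) (hT : ∀ l, |v l| ≤ T) (i : ℕ) :
    |at1 v i| ≤ T := by
  unfold at1; split_ifs
  · exact hT _
  · simpa using hT0

/-- The left-hand side of the linear system defining `kappa`. -/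
noncomputable def corrOp (θ : Fin p → ℝ) (Y : Fin (p - 1) → ℝ) : Fin (p - 1) → ℝ := fun j =>
  at1 Y (j + 1) - ∑ k ∈ Finset.Icc 1 (j : ℕ), at1 θ (j + 1 - k) * at1 Y k
    - ∑ k ∈ Finset.Icc 1 (p - (j + 1)), at1 θ (k + (j + 1)) * at1 Y k

theorem isCorrSolution_iff (θ : Fin p → ℝ) (Y : Fin (p - 1) → ℝ) :
    IsCorrSolution θ Y ↔ ∀ j : Fin (p - 1), corrOp θ Y j = at1 θ (j + 1) := by
  constructor
  · intro h j
    have := h (j + 1) (Finset.mem_Icc.2 ⟨by omega, by omega⟩)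
    rwa [Nat.add_sub_cancel] at this
  · intro h j hj
    obtain ⟨h1, h2⟩ := Finset.mem_Icc.1 hj
    obtain ⟨j, rfl⟩ : ∃ i, j = i + 1 := ⟨j - 1, by omega⟩
    rw [Nat.add_sub_cancel]
    exact h ⟨j, by omega⟩

theorem corrOp_sub (θ : Fin p → ℝ) (Y Z : Fin (p - 1) → ℝ) :
    corrOp θ (Y - Z) = corrOp θ Y - corrOp θ Z := by
  funext j
  simp only [corrOp, at1_sub, mul_sub, Finset.sum_sub_distrib, Pi.sub_apply]
  ring

theorem corrOp_smul (θ : Fin p → ℝ) (c : ℝ) (Y : Fin (p - 1) → ℝ) :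
    corrOp θ (c • Y) = c • corrOp θ Y := by
  funext j
  simp only [corrOp, at1_smul, Pi.smul_apply, smul_eq_mul, mul_sub, Finset.mul_sum,
    mul_left_comm]

theorem isCorrSolution_kappa {θ : Fin p → ℝ} (h : ∃! Y : Fin (p - 1) → ℝ, IsCorrSolution θ Y) :
    IsCorrSolution θ (kappa θ) := by
  rw [kappa, dif_pos h]
  exact h.choose_spec.1

/-- A kernel vector subtracted from `kappa` would give a second solution, so the operator is
injective; compactness of K times the unit sphere and homogeneity give a uniform constant. -/
theorem exists_corrOp_lower_bound {K : Set (Fin p → ℝ)} (hK : IsCompact K)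
    (hKe : ∀ θ ∈ K, ∃! Y : Fin (p - 1) → ℝ, IsCorrSolution θ Y) :
    ∃ c : ℝ, 0 < c ∧ ∀ θ ∈ K, ∀ Y, c * ‖Y‖ ≤ ‖corrOp θ Y‖ := by
  have hcont : Continuous fun x : (Fin p → ℝ) × (Fin (p - 1) → ℝ) => ‖corrOp x.1 x.2‖ := by
    unfold corrOp; fun_prop
  obtain ⟨c, hc, h⟩ := (hK.prod (isCompact_sphere (0 : Fin (p - 1) → ℝ) 1)).exists_forall_le'
    hcont.continuousOn (a := 0) (by
      rintro ⟨θ, Y⟩ ⟨hθ, hY⟩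
      refine norm_pos_iff.2 fun h0 => ?_
      have hk := isCorrSolution_kappa (hKe θ hθ)
      have hk2 : IsCorrSolution θ (kappa θ - Y) := by
        rw [isCorrSolution_iff] at hk ⊢
        intro j
        rw [corrOp_sub, h0, sub_zero, hk j]
      have hY0 : Y = 0 := sub_eq_self.1 ((hKe θ hθ).unique hk2 hk)
      simp [hY0] at hY)
  refine ⟨c, hc, fun θ hθ Y => ?_⟩
  rcases eq_or_ne Y 0 with rfl | hY
  · simp
  have hYn : 0 < ‖Y‖ := norm_pos_iff.2 hY
  have h1 := h (θ, ‖Y‖⁻¹ • Y) ⟨hθ, by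
    rw [mem_sphere_zero_iff_norm, norm_smul, norm_inv, norm_norm, inv_mul_cancel₀ hYn.ne']⟩
  simp only [corrOp_smul, norm_smul, norm_inv, norm_norm] at h1
  rwa [inv_mul_eq_div, le_div_iff₀ hYn] at h1

/-- Cutting the Yule-Walker sum at l = J and putting k = |l - J| produces the two sums of the
system. -/
theorem sum_mul_natAbs_split (f r : ℕ → ℝ) {J : ℕ} (hJ : 1 ≤ J) (hJp : J ≤ p) :
    ∑ l ∈ Finset.Icc 1 p, f l * r ((l : ℤ) - (J : ℤ)).natAbs =
      ∑ k ∈ Finset.Icc 1 (J - 1), f (J - k) * r k + f J * r 0 +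
        ∑ k ∈ Finset.Icc 1 (p - J), f (k + J) * r k := by
  have hset : Finset.Icc 1 p = (Finset.Icc 1 (J - 1) ∪ {J}) ∪ Finset.Icc (J + 1) p := by
    ext l; simp only [Finset.mem_Icc, Finset.mem_union, Finset.mem_singleton]; omega
  rw [hset, Finset.sum_union, Finset.sum_union, Finset.sum_singleton]
  · congr 1
    · congr 1
      · refine Finset.sum_nbij' (fun k => J - k) (fun k => J - k) ?_ ?_ ?_ ?_ ?_
        all_goals intro k hk; simp only [Finset.mem_Icc] at hk ⊢
        · omega
        · omega
        · omega
        · omega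
        · rw [show J - (J - k) = k by omega, show ((k : ℤ) - (J : ℤ)).natAbs = J - k by omega]
      · simp
    · refine Finset.sum_nbij' (fun k => k - J) (fun k => k + J) ?_ ?_ ?_ ?_ ?_
      all_goals intro k hk; simp only [Finset.mem_Icc] at hk ⊢
      · omega
      · omega
      · omega
      · omega
      · rw [show k - J + J = k by omega, show ((k : ℤ) - (J : ℤ)).natAbs = k - J by omega]
  · rw [Finset.disjoint_left]; intro l; simp only [Finset.mem_Icc, Finset.mem_singleton]; omega
  · rw [Finset.disjoint_left]; intro l
    simp only [Finset.mem_Icc, Finset.mem_singleton, Finset.mem_union]; omega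

/-- Slide along the diagonal to row 0, losing γ at each of fewer than p steps. -/
theorem abs_sub_first_row_le {m : Fin p → Fin p → ℝ} {γ : ℝ} (hγ : 0 ≤ γ)
    (hsymm : ∀ i j, m i j = m j i)
    (htoep : ∀ i j (hi : i + 1 < p) (hj : j + 1 < p),
      |m ⟨i + 1, hi⟩ ⟨j + 1, hj⟩ - m ⟨i, by omega⟩ ⟨j, by omega⟩| ≤ γ)
    {r : ℕ → ℝ} (hr : ∀ d (hd : d < p), r d = m ⟨0, by omega⟩ ⟨d, hd⟩) (i j : Fin p) :
    |m i j - r ((i : ℤ) - (j : ℤ)).natAbs| ≤ p * γ := by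
  have key : ∀ i d (hid : i + d < p),
      |m ⟨i, by omega⟩ ⟨i + d, hid⟩ - r d| ≤ i * γ := by
    intro i d
    induction i with
    | zero => intro hid; simp [hr d (by omega)]
    | succ i ih =>
      intro hid
      have h1 := htoep i (i + d) (by omega) (by omega)
      have h2 := ih (by omega)
      have e : (⟨i + 1 + d, hid⟩ : Fin p) = ⟨i + d + 1, by omega⟩ := by ext; simp; omega
      rw [e]
      push_cast
      rw [abs_le] at *
      constructor <;> linarith
  rcases le_total (i : ℕ) j with hij | hij
  · have h := key i (j - i) (by omega)
    have e : (⟨(i : ℕ) + (j - i), by omega⟩ : Fin p) = j := by ext; simp; omega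
    rw [e] at h
    rw [show ((i : ℤ) - (j : ℤ)).natAbs = (j : ℕ) - i by omega]
    refine h.trans ?_
    gcongr
    exact i.2.le
  · have h := key j (i - j) (by omega)
    have e : (⟨(j : ℕ) + (i - j), by omega⟩ : Fin p) = i := by ext; simp; omega
    rw [e, hsymm] at h
    rw [show ((i : ℤ) - (j : ℤ)).natAbs = (i : ℕ) - j by omega]
    refine h.trans ?_
    gcongr
    exact j.2.le

/-- A symmetric, nearly Toeplitz matrix with nearly prescribed trace which nearly satisfies the
Yule-Walker equations is close to a multiple of `L θ`. -/
theorem abs_sub_smul_L_le (hp : 1 ≤ p) {θ : Fin p → ℝ}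
    (hθ : ∃! Y : Fin (p - 1) → ℝ, IsCorrSolution θ Y) {c T v γ : ℝ} (hc : 0 < c)
    (hcθ : ∀ Y, c * ‖Y‖ ≤ ‖corrOp θ Y‖) (hT0 : 0 ≤ T) (hT : ∀ l, |θ l| ≤ T) (hγ : 0 ≤ γ)
    {m : Fin p → Fin p → ℝ} (hsymm : ∀ i j, m i j = m j i)
    (htoep : ∀ i j (hi : i + 1 < p) (hj : j + 1 < p),
      |m ⟨i + 1, hi⟩ ⟨j + 1, hj⟩ - m ⟨i, by omega⟩ ⟨j, by omega⟩| ≤ γ)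
    (hyw : ∀ j (hj : j + 1 < p),
      |m ⟨0, hp⟩ ⟨j + 1, hj⟩ - ∑ l, θ l * m l ⟨j, by omega⟩| ≤ γ)
    (htr : |∑ i, m i i - p * v| ≤ γ) (i j : Fin p) :
    |m i j - v * L θ i j| ≤ (2 * p + 1 + (T * (p + 1) + 1 + p * (p * T)) / c) * γ := by
  set r : ℕ → ℝ := fun d => if hd : d < p then m ⟨0, hp⟩ ⟨d, hd⟩ else 0 with hr
  have hrow := abs_sub_first_row_le hγ hsymm htoep (r := r) (fun d hd => by simp [hr, hd])
  have hp0 : (0 : ℝ) < p := by exact_mod_cast hp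
  have hr0 : |r 0 - v| ≤ (p + 1) * γ := by
    have h1 : |∑ i : Fin p, (m i i - r 0)| ≤ p * (p * γ) := by
      refine (Finset.abs_sum_le_sum_abs _ _).trans ?_
      calc _ ≤ ∑ _i : Fin p, p * γ := Finset.sum_le_sum fun i _ => by simpa using hrow i i
        _ = _ := by simp
    have h2 : (p : ℝ) * (r 0 - v) = (∑ i, m i i - p * v) - ∑ i : Fin p, (m i i - r 0) := by
      simp [Finset.sum_sub_distrib]; ring
    have h3 : (p : ℝ) * |r 0 - v| ≤ γ + p * (p * γ) := by
      rw [← abs_of_pos hp0, ← abs_mul, abs_of_pos hp0, h2]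
      exact (abs_sub _ _).trans (add_le_add htr h1)
    have hp1 : (1 : ℝ) ≤ p := by exact_mod_cast hp
    have h4 : γ ≤ p * γ := le_mul_of_one_le_left hγ hp1
    refine le_of_mul_le_mul_left ?_ hp0
    linarith
  set ρ : Fin (p - 1) → ℝ := fun d => r (d + 1) with hρ
  have hat : ∀ k, 1 ≤ k → k ≤ p - 1 → at1 ρ k = r k := by
    intro k h1 h2
    rw [at1, dif_pos ⟨h1, h2⟩, hρ]
    simp only
    rw [Nat.sub_add_cancel h1]
  have hop : ‖corrOp θ (ρ - v • kappa θ)‖ ≤ (T * (p + 1) + 1 + p * (p * T)) * γ := by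
    refine (pi_norm_le_iff_of_nonneg (by positivity)).2 fun j => ?_
    have hjp : (j : ℕ) + 1 < p := by omega
    have h1 : corrOp θ ρ j = r (j + 1) + at1 θ (j + 1) * r 0 -
        ∑ l : Fin p, θ l * r ((l : ℤ) - (j : ℤ)).natAbs := by
      have h2 := sum_mul_natAbs_split (at1 θ) r (J := j + 1) (p := p) (by omega) (by omega)
      rw [sum_Icc_one_eq_sum_fin, Nat.add_sub_cancel] at h2
      simp only [at1_succ, Nat.cast_add, Nat.cast_one, add_sub_add_right_eq_sub] at h2
      rw [h2, corrOp, hat _ (by omega) (by omega)]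
      have e1 : ∑ k ∈ Finset.Icc 1 (j : ℕ), at1 θ (j + 1 - k) * at1 ρ k =
          ∑ k ∈ Finset.Icc 1 (j : ℕ), at1 θ (j + 1 - k) * r k :=
        Finset.sum_congr rfl fun k hk => by
          rw [Finset.mem_Icc] at hk; rw [hat k (by omega) (by omega)]
      have e2 : ∑ k ∈ Finset.Icc 1 (p - (j + 1)), at1 θ (k + (j + 1)) * at1 ρ k =
          ∑ k ∈ Finset.Icc 1 (p - (j + 1)), at1 θ (k + (j + 1)) * r k :=
        Finset.sum_congr rfl fun k hk => by
          rw [Finset.mem_Icc] at hk; rw [hat k (by omega) (by omega)]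
      rw [e1, e2]
      ring
    have h3 := (isCorrSolution_iff θ _).1 (isCorrSolution_kappa hθ) j
    have h4 : |∑ l : Fin p, θ l * (m l ⟨j, by omega⟩ - r ((l : ℤ) - (j : ℤ)).natAbs)| ≤
        p * (p * T) * γ := by
      refine (Finset.abs_sum_le_sum_abs _ _).trans ?_
      calc _ ≤ ∑ _l : Fin p, T * (p * γ) := Finset.sum_le_sum fun l _ => by
            rw [abs_mul]
            exact mul_le_mul (hT l) (hrow l ⟨j, by omega⟩) (abs_nonneg _) hT0
        _ = _ := by simp; ring
    have h5 := hyw j hjp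
    have h6 : |at1 θ (j + 1) * (r 0 - v)| ≤ T * ((p + 1) * γ) := by
      rw [abs_mul]
      exact mul_le_mul (abs_at1_le hT0 hT _) hr0 (abs_nonneg _) hT0
    -- The residual has three sources: the diagonal value against v, the Yule-Walker defect, and the
    -- Toeplitz defect.
    have h7 : corrOp θ (ρ - v • kappa θ) j = at1 θ (j + 1) * (r 0 - v) +
        (m ⟨0, hp⟩ ⟨j + 1, hjp⟩ - ∑ l, θ l * m l ⟨j, by omega⟩) +
        ∑ l : Fin p, θ l * (m l ⟨j, by omega⟩ - r ((l : ℤ) - (j : ℤ)).natAbs) := by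
      rw [corrOp_sub, corrOp_smul, Pi.sub_apply, Pi.smul_apply, h1, h3, smul_eq_mul,
        show r (j + 1) = m ⟨0, hp⟩ ⟨j + 1, hjp⟩ from dif_pos hjp]
      simp only [mul_sub, Finset.sum_sub_distrib]
      ring
    rw [Real.norm_eq_abs, h7]
    refine (abs_add_three _ _ _).trans ?_
    linarith
  have hY : ‖ρ - v • kappa θ‖ ≤ (T * (p + 1) + 1 + p * (p * T)) / c * γ := by
    rw [div_mul_eq_mul_div, le_div_iff₀ hc, mul_comm]
    exact (hcθ _).trans hop
  have hE : 0 ≤ (T * (p + 1) + 1 + p * (p * T)) / c * γ := (norm_nonneg _).trans hY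
  by_cases hij : i = j
  · subst hij
    have h1 := hrow i i
    simp only [sub_self, Int.natAbs_zero] at h1
    simp only [L, Matrix.of_apply, if_true, mul_one]
    have h2 := abs_add_le (m i i - r 0) (r 0 - v)
    rw [sub_add_sub_cancel] at h2
    linarith
  · have h1 := hrow i j
    set d := ((i : ℤ) - (j : ℤ)).natAbs with hd
    have hij' : (i : ℕ) ≠ j := fun h => hij (Fin.ext h)
    have hd1 : 1 ≤ d := by omega
    have hd2 : d ≤ p - 1 := by omega
    simp only [L, Matrix.of_apply, if_neg hij, ← hd]
    have h3 : |r d - v * at1 (kappa θ) d| ≤ (T * (p + 1) + 1 + p * (p * T)) / c * γ := by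
      rw [← hat d hd1 hd2, ← at1_smul, ← at1_sub]
      exact abs_at1_le hE (fun l => (norm_le_pi_norm _ l).trans hY) d
    have h2 := abs_add_le (m i j - r d) (r d - v * at1 (kappa θ) d)
    rw [sub_add_sub_cancel] at h2
    nlinarith [mul_nonneg hp0.le hγ]

theorem frobenius_norm_le {A : Matrix (Fin p) (Fin p) ℝ} {b : ℝ} (hb : 0 ≤ b)
    (h : ∀ i j, |A i j| ≤ b) : ‖A‖ ≤ p * b := by
  rw [Matrix.frobenius_norm_def, ← Real.sqrt_eq_rpow]
  refine Real.sqrt_le_iff.2 ⟨by positivity, ?_⟩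
  calc _ ≤ ∑ _i : Fin p, ∑ _j : Fin p, b ^ 2 := by
        gcongr with i _ j _
        rw [Real.rpow_two]
        exact pow_le_pow_left₀ (norm_nonneg _) (h i j) 2
    _ = _ := by simp; ring

/-! ### The matrix M at the crossing time. -/

theorem state_succ_succ (θ : Fin p → ℝ) (e : ℕ → ℝ) (n i : ℕ) (hi : i + 1 < p) :
    state θ e (n + 1) ⟨i + 1, hi⟩ = state θ e n ⟨i, by omega⟩ := by
  simp [state]

theorem M_succ (θ : Fin p → ℝ) (e : ℕ → ℝ) (n : ℕ) (i j : Fin p) :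
    M θ e (n + 1) i j = M θ e n i j + state θ e n i * state θ e n j := by
  rw [M_apply, M_apply, Finset.sum_range_succ]

theorem M_succ_shift (θ : Fin p → ℝ) (e : ℕ → ℝ) (n i j : ℕ) (hi : i + 1 < p) (hj : j + 1 < p) :
    M θ e (n + 1) ⟨i + 1, hi⟩ ⟨j + 1, hj⟩ = M θ e n ⟨i, by omega⟩ ⟨j, by omega⟩ := by
  rw [M_apply, M_apply, Finset.sum_range_succ', state_zero]
  simp only [state_succ_succ, Pi.zero_apply, mul_zero, add_zero]

theorem M_succ_first_row (hp : 1 ≤ p) (θ : Fin p → ℝ) (e : ℕ → ℝ) (n j : ℕ) (hj : j + 1 < p) :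
    M θ e (n + 1) ⟨0, hp⟩ ⟨j + 1, hj⟩ = ∑ l, θ l * M θ e n l ⟨j, by omega⟩ +
      ∑ k ∈ Finset.range n, e k * state θ e k ⟨j, by omega⟩ := by
  simp only [M_apply, Finset.mul_sum]
  rw [Finset.sum_comm, Finset.sum_range_succ', state_zero, ← Finset.sum_add_distrib]
  simp only [Pi.zero_apply, mul_zero, add_zero]
  refine Finset.sum_congr rfl fun k _ => ?_
  rw [state_succ_succ]
  have : state θ e (k + 1) ⟨0, hp⟩ = ∑ l, θ l * state θ e k l + e k := by
    simp only [state, Nat.sub_zero, path_succ]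
  rw [this, add_mul, Finset.sum_mul]
  simp only [mul_assoc]

/-- If the last state and the noise sums `∑ ε_k x_{k-j}` are negligible when the trace crosses
`σ ^ 2 h`, then `M / h` is close to `σ ^ 2 / p • L`. -/
theorem exists_norm_sub_smul_L_le (hp : 1 ≤ p) {K : Set (Fin p → ℝ)} (hK : IsCompact K)
    (hKe : ∀ θ ∈ K, ∃! Y : Fin (p - 1) → ℝ, IsCorrSolution θ Y) {T : ℝ} (hT0 : 0 ≤ T)
    (hT : ∀ θ ∈ K, ∀ l, |θ l| ≤ T) :
    ∃ C : ℝ, 0 < C ∧ ∀ θ ∈ K, ∀ (e : ℕ → ℝ) (s : ℕ) (σ h γ : ℝ), 0 < h → 0 ≤ γ →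
      (M θ e s).trace < h * σ ^ 2 → h * σ ^ 2 ≤ (M θ e (s + 1)).trace →
      (∀ i, |state θ e s i| ≤ √(γ * h)) →
      (∀ j : Fin p, |∑ k ∈ Finset.range s, e k * state θ e k j| ≤ γ * h) →
      ‖(1 / h) • M θ e (s + 1) - (σ ^ 2 / (p : ℝ)) • L θ‖ ≤ C * γ := by
  obtain ⟨c, hc, hcK⟩ := exists_corrOp_lower_bound hK hKe
  have hp0 : (0 : ℝ) < p := by exact_mod_cast hp
  refine ⟨p * ((2 * p + 1 + (T * (p + 1) + 1 + p * (p * T)) / c) * (1 + p * T + p)),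
    by positivity, ?_⟩
  intro θ hθ e s σ h γ hh hγ hlt hle hst hns
  have hprod : ∀ i j, |state θ e s i * state θ e s j| ≤ γ * h := by
    intro i j
    rw [abs_mul, ← Real.mul_self_sqrt (mul_nonneg hγ hh.le)]
    exact mul_le_mul (hst i) (hst j) (abs_nonneg _) (Real.sqrt_nonneg _)
  have hγ' : γ ≤ (1 + p * T + p) * γ := by
    nlinarith [mul_nonneg (mul_nonneg hp0.le hT0) hγ, mul_nonneg hp0.le hγ]
  have hscale : ∀ x y : ℝ, |x| ≤ y * h → |1 / h * x| ≤ y := by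
    intro x y hxy
    rw [abs_mul, abs_of_pos (by positivity), one_div_mul_eq_div, div_le_iff₀ hh]
    exact hxy
  rw [mul_assoc (p : ℝ), mul_assoc _ _ γ]
  refine frobenius_norm_le (by positivity) fun i j => ?_
  simp only [Matrix.sub_apply, Matrix.smul_apply, smul_eq_mul]
  refine abs_sub_smul_L_le hp (hKe θ hθ) hc (hcK θ hθ) hT0 (hT θ hθ) (by positivity)
    (m := fun i j => 1 / h * M θ e (s + 1) i j) ?_ ?_ ?_ ?_ i j
  · intro i j
    simp only [M_apply, mul_comm]
  · intro i j hi hj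
    rw [← mul_sub, M_succ_shift, M_succ, sub_add_cancel_left]
    exact (hscale _ _ (by rw [abs_neg]; exact hprod _ _)).trans hγ'
  · intro j hj
    have e1 : 1 / h * M θ e (s + 1) ⟨0, hp⟩ ⟨j + 1, hj⟩ -
        ∑ l, θ l * (1 / h * M θ e (s + 1) l ⟨j, by omega⟩) =
        1 / h * (∑ k ∈ Finset.range s, e k * state θ e k ⟨j, by omega⟩ -
          ∑ l, θ l * (state θ e s l * state θ e s ⟨j, by omega⟩)) := by
      rw [M_succ_first_row]
      simp only [M_succ, mul_add, Finset.sum_add_distrib, mul_left_comm _ (1 / h),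
        ← Finset.mul_sum]
      ring
    rw [e1]
    refine hscale _ _ ((abs_sub _ _).trans ?_)
    have e2 : |∑ l, θ l * (state θ e s l * state θ e s ⟨j, by omega⟩)| ≤ p * T * (γ * h) := by
      refine (Finset.abs_sum_le_sum_abs _ _).trans ?_
      calc _ ≤ ∑ _l : Fin p, T * (γ * h) := Finset.sum_le_sum fun l _ => by
            rw [abs_mul]
            exact mul_le_mul (hT θ hθ l) (hprod _ _) (abs_nonneg _) hT0
        _ = _ := by simp; ring
    have e3 : 0 ≤ p * (γ * h) := by positivity
    linarith [hns ⟨j, by omega⟩]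
  -- The overshoot of the trace is at most the squared length of the last state.
  · have e1 : ∑ i, 1 / h * M θ e (s + 1) i i - p * (σ ^ 2 / p) =
        1 / h * ((M θ e (s + 1)).trace - h * σ ^ 2) := by
      rw [← Finset.mul_sum, mul_sub, Matrix.trace]
      simp only [Matrix.diag_apply]
      field_simp
    rw [e1]
    refine hscale _ _ ?_
    rw [abs_of_nonneg (by linarith)]
    have e2 : (M θ e (s + 1)).trace = (M θ e s).trace + ∑ i, state θ e s i * state θ e s i := by
      simp only [Matrix.trace, Matrix.diag_apply, M_succ, Finset.sum_add_distrib]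
    have e3 : ∑ i, state θ e s i * state θ e s i ≤ p * (γ * h) := by
      calc _ ≤ ∑ _i : Fin p, γ * h := Finset.sum_le_sum fun i _ =>
            (le_abs_self _).trans (hprod i i)
        _ = _ := by simp
    have e4 : 0 ≤ γ * h := by positivity
    have e5 : 0 ≤ p * T * (γ * h) := by positivity
    linarith

end Deterministic

/-! ### Martingale transforms of the noise. -/

section Past

variable {Ω : Type*}

/-- The information carried by `ε 0, ..., ε (n - 1)`. -/
abbrev past (ε : ℕ → Ω → ℝ) (n : ℕ) : MeasurableSpace Ω :=
  ⨆ i ∈ Set.Iio n, MeasurableSpace.comap (ε i) inferInstance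

theorem past_mono (ε : ℕ → Ω → ℝ) : Monotone (past ε) := fun _ _ h =>
  biSup_mono fun _ hi => lt_of_lt_of_le hi h

theorem measurable_past (ε : ℕ → Ω → ℝ) {i n : ℕ} (h : i < n) : Measurable[past ε n] (ε i) :=
  Measurable.of_comap_le (le_iSup₂_of_le i h le_rfl)

end Past

section Martingale

variable {Ω : Type*} [MeasurableSpace Ω] {P : Measure Ω}

theorem past_le {ε : ℕ → Ω → ℝ} (hmeas : ∀ n, Measurable (ε n)) (n : ℕ) :
    past ε n ≤ ‹MeasurableSpace Ω› :=
  iSup₂_le fun i _ => (hmeas i).comap_le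

theorem indepFun_of_measurable_past {ε : ℕ → Ω → ℝ} (hmeas : ∀ n, Measurable (ε n))
    (hindep : iIndepFun ε P) {n : ℕ} {f : Ω → ℝ} (hf : Measurable[past ε n] f) :
    IndepFun f (ε n) P := by
  have h := indep_iSup_of_disjoint (fun i => (hmeas i).comap_le) hindep.iIndep
    (S := Set.Iio n) (T := {n}) (by simp)
  rw [iSup_singleton] at h
  exact indep_of_indep_of_le_left h hf.comap_le

variable [IsProbabilityMeasure P]

/-- Each ξ n depends on earlier noise only, so ε n is independent of it and of the preceding sum;
being centred, it kills the cross terms. Boundedness of ξ supplies integrability. -/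
theorem integral_sq_sum_mul_eq {ε : ℕ → Ω → ℝ} (hmeas : ∀ n, Measurable (ε n))
    (hindep : iIndepFun ε P) (hL2 : ∀ n, MemLp (ε n) 2 P) (hmean : ∀ n, ∫ ω, ε n ω ∂P = 0)
    {v : ℝ} (hvar : ∀ n, ∫ ω, ε n ω ^ 2 ∂P = v) {ξ : ℕ → Ω → ℝ}
    (hξ : ∀ n, Measurable[past ε n] (ξ n)) {b : ℝ} (hb : ∀ n ω, |ξ n ω| ≤ b) (N : ℕ) :
    MemLp (fun ω => ∑ k ∈ Finset.range N, ε k ω * ξ k ω) 2 P ∧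
    ∫ ω, (∑ k ∈ Finset.range N, ε k ω * ξ k ω) ^ 2 ∂P =
      v * ∫ ω, ∑ k ∈ Finset.range N, ξ k ω ^ 2 ∂P := by
  have hξm : ∀ n, Measurable (ξ n) := fun n => (hξ n).mono (past_le hmeas n) le_rfl
  have hξb : ∀ n, MemLp (ξ n) ⊤ P := fun n =>
    memLp_top_of_bound (hξm n).aestronglyMeasurable b (ae_of_all _ fun ω => hb n ω)
  have hterm : ∀ n, MemLp (fun ω => ε n ω * ξ n ω) 2 P := fun n =>
    (hL2 n).of_le_mul ((hmeas n).mul (hξm n)).aestronglyMeasurable (c := b)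
      (ae_of_all _ fun ω => by
        rw [norm_mul, mul_comm]
        exact mul_le_mul_of_nonneg_right (hb n ω) (norm_nonneg _))
  have hξ2 : ∀ n, Integrable (fun ω => ξ n ω ^ 2) P := fun n =>
    ((hξb n).mono_exponent le_top).integrable_sq
  have hS : ∀ N, MemLp (fun ω => ∑ k ∈ Finset.range N, ε k ω * ξ k ω) 2 P := fun N =>
    memLp_finsetSum _ fun k _ => hterm k
  refine ⟨hS N, ?_⟩
  induction N with
  | zero => simp
  | succ N ih =>
    simp only [Finset.sum_range_succ, add_sq]
    set S : Ω → ℝ := fun ω => ∑ k ∈ Finset.range N, ε k ω * ξ k ω with hSdef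
    have hSm : Measurable[past ε N] S := by
      refine Finset.measurable_sum _ fun k hk => ?_
      have hk := Finset.mem_range.1 hk
      exact (measurable_past ε hk).mul ((hξ k).mono (past_mono ε hk.le) le_rfl)
    have hSξ : Measurable[past ε N] fun ω => S ω * ξ N ω := hSm.mul (hξ N)
    have hcross : ∫ ω, 2 * S ω * (ε N ω * ξ N ω) ∂P = 0 := by
      have h1 := (indepFun_of_measurable_past hmeas hindep hSξ).integral_fun_mul_eq_mul_integral
        (hSξ.mono (past_le hmeas N) le_rfl).aestronglyMeasurable
        (hmeas N).aestronglyMeasurable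
      rw [hmean N, mul_zero] at h1
      rw [← mul_zero (2 : ℝ), ← h1, ← integral_const_mul]
      congr 1; funext ω; ring
    have hsq : ∫ ω, (ε N ω * ξ N ω) ^ 2 ∂P = v * ∫ ω, ξ N ω ^ 2 ∂P := by
      have h1 := ((indepFun_of_measurable_past hmeas hindep (hξ N)).comp
        (φ := fun x : ℝ => x ^ 2) (ψ := fun x : ℝ => x ^ 2) (by fun_prop)
        (by fun_prop)).integral_fun_mul_eq_mul_integral
        ((hξm N).pow_const 2).aestronglyMeasurable ((hmeas N).pow_const 2).aestronglyMeasurable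
      simp only [Function.comp_apply] at h1
      rw [hvar N] at h1
      rw [mul_comm v, ← h1]
      congr 1; funext ω; ring
    have hcrossint : Integrable (fun ω => 2 * S ω * (ε N ω * ξ N ω)) P := by
      have := ((hS N).integrable_mul (hterm N)).const_mul 2
      refine this.congr (ae_of_all _ fun ω => ?_)
      simp only [Pi.mul_apply, hSdef]; ring
    rw [integral_add, integral_add, hcross, hsq, integral_add, mul_add, add_zero, ih]
    · exact integrable_finsetSum _ fun k _ => hξ2 k
    · exact hξ2 N
    · exact (hS N).integrable_sq
    · exact hcrossint
    · exact (hS N).integrable_sq.add hcrossint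
    · exact (hterm N).integrable_sq

theorem prob_abs_sum_mul_gt_le {ε : ℕ → Ω → ℝ} (hmeas : ∀ n, Measurable (ε n))
    (hindep : iIndepFun ε P) (hL2 : ∀ n, MemLp (ε n) 2 P) (hmean : ∀ n, ∫ ω, ε n ω ∂P = 0)
    {v : ℝ} (hvar : ∀ n, ∫ ω, ε n ω ^ 2 ∂P = v) {ξ : ℕ → Ω → ℝ}
    (hξ : ∀ n, Measurable[past ε n] (ξ n)) {A : ℝ} {N : ℕ}
    (hA : ∀ N ω, ∑ k ∈ Finset.range N, ξ k ω ^ 2 ≤ A) {t : ℝ} (ht : 0 < t) :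
    P {ω | t < |∑ k ∈ Finset.range N, ε k ω * ξ k ω|} ≤ ENNReal.ofReal (v * A / t ^ 2) := by
  have hb : ∀ n ω, |ξ n ω| ≤ √A := fun n ω => by
    refine Real.abs_le_sqrt ((Finset.single_le_sum (f := fun k => ξ k ω ^ 2)
      (fun _ _ => sq_nonneg _) (Finset.self_mem_range_succ n)).trans (hA (n + 1) ω))
  have hv : 0 ≤ v := by rw [← hvar 0]; exact integral_nonneg fun ω => sq_nonneg _
  obtain ⟨hS, hSI⟩ := integral_sq_sum_mul_eq hmeas hindep hL2 hmean hvar hξ hb N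
  have hle : ∫ ω, ∑ k ∈ Finset.range N, ξ k ω ^ 2 ∂P ≤ A := by
    have hA0 : 0 ≤ A := by simpa using hA 0 (Classical.choice P.nonempty_of_neZero)
    refine (integral_mono_of_nonneg (ae_of_all _ fun ω => Finset.sum_nonneg fun _ _ =>
      sq_nonneg _) (integrable_const A) (ae_of_all _ fun ω => hA N ω)).trans ?_
    simp
  have hM := mul_meas_ge_le_integral_of_nonneg (ae_of_all P fun ω => sq_nonneg
    (∑ k ∈ Finset.range N, ε k ω * ξ k ω)) hS.integrable_sq (t ^ 2)
  rw [hSI] at hM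
  calc _ ≤ P {ω | t ^ 2 ≤ (∑ k ∈ Finset.range N, ε k ω * ξ k ω) ^ 2} := by
        refine measure_mono fun ω hω => ?_
        simp only [Set.mem_ofPred_eq] at hω ⊢
        rw [← sq_abs (∑ k ∈ Finset.range N, ε k ω * ξ k ω)]
        gcongr
    _ = ENNReal.ofReal (P.real {ω | t ^ 2 ≤ (∑ k ∈ Finset.range N, ε k ω * ξ k ω) ^ 2}) :=
        (ofReal_measureReal).symm
    _ ≤ _ := by
        refine ENNReal.ofReal_le_ofReal ?_
        rw [le_div_iff₀ (by positivity), mul_comm]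
        exact hM.trans (mul_le_mul_of_nonneg_left hle hv)

end Martingale

/-! ### Strong law for the squared noise. -/

theorem eventually_forall_lt_le_mul {x : ℕ → ℝ} {v : ℝ}
    (h : Tendsto (fun n : ℕ => (∑ i ∈ Finset.range n, x i) / n) atTop (𝓝 v)) {a : ℝ}
    (ha : 0 < a) : ∀ᶠ N : ℕ in atTop, ∀ i < N, x i ≤ a * N := by
  -- Successive Cesàro means have the same limit, so x n is o(n).
  have h1 : Tendsto (fun n : ℕ => x n / ((n : ℝ) + 1)) atTop (𝓝 0) := by
    have h2 : Tendsto (fun n : ℕ => (n : ℝ) / ((n : ℝ) + 1)) atTop (𝓝 1) :=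
      tendsto_natCast_div_add_atTop 1
    have h3 := ((tendsto_add_atTop_iff_nat 1).2 h).sub (h.mul h2)
    rw [mul_one, sub_self] at h3
    refine h3.congr fun n => ?_
    rw [Finset.sum_range_succ]
    push_cast
    rcases Nat.eq_zero_or_pos n with rfl | hn
    · simp
    · have : (n : ℝ) ≠ 0 := by exact_mod_cast hn.ne'
      field_simp
      ring
  obtain ⟨n₀, hn₀⟩ := eventually_atTop.1 (h1.eventually_le_const ha)
  have h4 : ∀ᶠ N : ℕ in atTop, ∀ i < n₀, x i ≤ a * N := by
    have : ∀ i ∈ Finset.range n₀, ∀ᶠ N : ℕ in atTop, x i ≤ a * N := fun i _ =>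
      (tendsto_natCast_atTop_atTop.const_mul_atTop ha).eventually_ge_atTop (x i)
    filter_upwards [(Finset.eventually_all (Finset.range n₀)).2 this] with N hN i hi
    exact hN i (Finset.mem_range.2 hi)
  filter_upwards [h4] with N hN i hi
  rcases lt_or_ge i n₀ with h5 | h5
  · exact hN i h5
  · have h6 := hn₀ i h5
    rw [div_le_iff₀ (by positivity)] at h6
    refine h6.trans ?_
    have : (i : ℝ) + 1 ≤ N := by exact_mod_cast hi
    gcongr

section LawOfLargeNumbers

variable {Ω : Type*} [MeasurableSpace Ω] {P : Measure Ω} [IsProbabilityMeasure P]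

theorem tendsto_prob_noise_irregular {ε : ℕ → Ω → ℝ} (hmeas : ∀ n, Measurable (ε n))
    (hindep : iIndepFun ε P) (hident : ∀ n, IdentDistrib (ε n) (ε 0) P P)
    (hL2 : MemLp (ε 0) 2 P) {v : ℝ} (hv : 0 < v) (hvar : ∫ ω, (ε 0 ω) ^ 2 ∂P = v)
    {a : ℝ} (ha : 0 < a) :
    Tendsto (fun N : ℕ => P {ω | ¬ (N * (v / 2) ≤ ∑ i ∈ Finset.range N, ε i ω ^ 2 ∧
      ∀ i < N, ε i ω ^ 2 ≤ a * N)}) atTop (𝓝 0) := by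
  have hlln := strong_law_ae_real (μ := P) (fun n ω => ε n ω ^ 2) hL2.integrable_sq
    (fun i j hij => (hindep.indepFun hij).comp (φ := fun x : ℝ => x ^ 2)
      (ψ := fun x : ℝ => x ^ 2) (measurable_id.pow_const 2) (measurable_id.pow_const 2))
    (fun i => (hident i).comp (u := fun x : ℝ => x ^ 2) (by fun_prop))
  rw [hvar] at hlln
  rw [← measure_empty (μ := P)]
  refine tendsto_measure_of_ae_tendsto_indicator_of_isFiniteMeasure atTop MeasurableSet.empty
    (fun N => ?_) ?_
  · refine measurableSet_setOfPred.2 (Measurable.not (Measurable.and ?_ ?_))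
    · exact measurableSet_setOfPred.1 (measurableSet_le measurable_const (by fun_prop))
    · exact Measurable.forall fun i => Measurable.imp measurable_const
        (measurableSet_setOfPred.1 (measurableSet_le ((hmeas i).pow_const 2) measurable_const))
  · filter_upwards [hlln] with ω hω
    filter_upwards [eventually_forall_lt_le_mul hω ha,
      hω.eventually_const_le (half_lt_self hv), eventually_gt_atTop 0] with N h1 h2 h3
    have h4 : (0 : ℝ) < N := by exact_mod_cast h3
    simp only [Set.mem_empty_iff_false, iff_false, not_not]
    exact ⟨by rwa [le_div_iff₀ h4, mul_comm] at h2, h1⟩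

end LawOfLargeNumbers

/-! ### Predictability and stopping. -/

section Measurability

variable {Ω : Type*} {p : ℕ}

theorem measurable_past_path (θ : Fin p → ℝ) (ε : ℕ → Ω → ℝ) (n : ℕ) :
    Measurable[past ε n] fun ω => path θ (fun k => ε k ω) n := by
  induction n using Nat.strong_induction_on with
  | _ n ih =>
    cases n with
    | zero => simp only [path_zero]; exact @measurable_const _ _ _ (past ε 0) _
    | succ n =>
      simp only [path_succ]
      refine Measurable.add (Finset.measurable_sum _ fun l _ => ?_)
        (measurable_past ε n.lt_succ_self)
      exact ((ih (n - l) (by omega)).mono (past_mono ε (by omega)) le_rfl).const_mul _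

theorem measurable_past_state (θ : Fin p → ℝ) (ε : ℕ → Ω → ℝ) {m n : ℕ} (hmn : m ≤ n)
    (i : Fin p) : Measurable[past ε n] fun ω => state θ (fun k => ε k ω) m i :=
  (measurable_past_path θ ε _).mono (past_mono ε ((Nat.sub_le _ _).trans hmn)) le_rfl

/-- M_{n+1} uses states up to time n only, so it is known before `ε n`: the switch in `stoppedState`
is predictable. -/
theorem measurable_past_trace_M (θ : Fin p → ℝ) (ε : ℕ → Ω → ℝ) (n : ℕ) :
    Measurable[past ε n] fun ω => (M θ (fun k => ε k ω) (n + 1)).trace := by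
  simp only [trace_M]
  refine Finset.measurable_sum _ fun m hm => Finset.measurable_sum _ fun i _ => ?_
  exact (measurable_past_state θ ε (by simpa [Nat.lt_succ_iff] using hm) i).pow_const 2

end Measurability

/-- The `j`-th coordinate of the state at time `k`, switched off once the trace has reached
`A`. -/
noncomputable def stoppedState {p : ℕ} (θ : Fin p → ℝ) (A : ℝ) (j : Fin p) (e : ℕ → ℝ) (k : ℕ) :
    ℝ :=
  if (M θ e (k + 1)).trace < A then state θ e k j else 0

theorem sum_sq_stoppedState_le {p : ℕ} (θ : Fin p → ℝ) {A : ℝ} (hA : 0 ≤ A) (j : Fin p)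
    (e : ℕ → ℝ) (N : ℕ) : ∑ k ∈ Finset.range N, stoppedState θ A j e k ^ 2 ≤ A := by
  induction N with
  | zero => simpa using hA
  | succ N ih =>
    rw [Finset.sum_range_succ]
    by_cases h : (M θ e (N + 1)).trace < A
    · refine le_trans ?_ h.le
      rw [trace_M, ← Finset.sum_range_succ (fun k => stoppedState θ A j e k ^ 2)]
      refine Finset.sum_le_sum fun k _ => ?_
      refine le_trans ?_ (Finset.single_le_sum (f := fun i => state θ e k i ^ 2)
        (fun _ _ => sq_nonneg _) (Finset.mem_univ j))
      unfold stoppedState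
      split_ifs
      · exact le_rfl
      · simpa using sq_nonneg _
    · simpa [stoppedState, h] using ih

/-- This turns the sum up to the random crossing time into one of fixed length N, so no optional
stopping is needed. -/
theorem sum_mul_stoppedState_eq {p : ℕ} {θ : Fin p → ℝ} {A : ℝ} (j : Fin p) {e : ℕ → ℝ}
    {s N : ℕ} (hsN : s ≤ N) (hlt : (M θ e s).trace < A) (hle : A ≤ (M θ e (s + 1)).trace) :
    ∑ k ∈ Finset.range N, e k * stoppedState θ A j e k =
      ∑ k ∈ Finset.range s, e k * state θ e k j := by
  rw [← Finset.sum_subset (Finset.range_mono hsN)]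
  · refine Finset.sum_congr rfl fun k hk => ?_
    have hk := Finset.mem_range.1 hk
    rw [stoppedState, if_pos ((trace_M_mono θ e hk).trans_lt hlt)]
  · intro k _ hk
    have hk : s ≤ k := by simpa using hk
    rw [stoppedState, if_neg (not_lt.2 (hle.trans (trace_M_mono θ e (by omega)))), mul_zero]

/-- `tau` is the successor of the last time at which the trace is below the threshold. -/
theorem exists_tau_eq_succ {p : ℕ} {θ : Fin p → ℝ} {e : ℕ → ℝ} {σ h : ℝ} (hpos : 0 < h * σ ^ 2)
    {N : ℕ} (hN : h * σ ^ 2 ≤ (M θ e (N + 1)).trace) :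
    ∃ s ≤ N, tau θ e σ h = ((s + 1 : ℕ) : ℕ∞) ∧ (M θ e s).trace < h * σ ^ 2 ∧
      h * σ ^ 2 ≤ (M θ e (s + 1)).trace := by
  set S := {n : ℕ | 1 ≤ n ∧ h * σ ^ 2 ≤ (M θ e n).trace} with hS
  have hNS : N + 1 ∈ S := ⟨by omega, hN⟩
  have hmem : sInf S ∈ S := Nat.sInf_mem ⟨_, hNS⟩
  obtain ⟨s, hs⟩ : ∃ s, sInf S = s + 1 := ⟨sInf S - 1, by have := hmem.1; omega⟩
  have hle : sInf S ≤ N + 1 := Nat.sInf_le hNS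
  rw [hs] at hmem
  refine ⟨s, by omega, ?_, ?_, hmem.2⟩
  · rw [tau, ← hS, ← hs]
    exact (IsLeast.csInf_eq ⟨⟨sInf S, hs ▸ hmem, rfl⟩, by
      rintro _ ⟨n, hn, rfl⟩
      exact Nat.cast_le.2 (Nat.sInf_le hn)⟩)
  · by_contra! hcon
    rcases Nat.eq_zero_or_pos s with rfl | h0
    · rw [trace_M, Finset.sum_range_zero] at hcon
      linarith
    · have : sInf S ≤ s := Nat.sInf_le ⟨h0, hcon⟩
      omega

end SeqAR

/-! ### Choice of constants and conclusion. -/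

open SeqAR in
theorem lemma3p4 (p : ℕ) (hp : 1 ≤ p)
    {Ω : Type*} [MeasurableSpace Ω] (P : Measure Ω) [IsProbabilityMeasure P]
    (ε : ℕ → Ω → ℝ) (hmeas : ∀ n, Measurable (ε n))
    (hindep : iIndepFun ε P) (hident : ∀ n, IdentDistrib (ε n) (ε 0) P P)
    (hL2 : MemLp (ε 0) 2 P) (hmean : ∫ ω, ε 0 ω ∂P = 0)
    (σ : ℝ) (hσ : 0 < σ) (hvar : ∫ ω, (ε 0 ω) ^ 2 ∂P = σ ^ 2)
    (K : Set (Fin p → ℝ)) (hK : IsCompact K) (hKadm : K ⊆ SeqAR.admissible p)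
    (δ : ℝ) (hδ : 0 < δ) :
    Tendsto
      (fun h : ℝ => ⨆ θ ∈ K,
        P {ω | SeqAR.tau θ (fun n => ε n ω) σ h = ⊤ ∨
          δ < ‖(1 / h) • SeqAR.M θ (fun n => ε n ω) (SeqAR.tau θ (fun n => ε n ω) σ h).toNat
                - (σ ^ 2 / (p : ℝ)) • SeqAR.L θ‖})
      atTop (𝓝 0) := by
  obtain ⟨B, hB, hBK⟩ := exists_impulse_response_bound hK fun θ hθ => (hKadm hθ).1
  obtain ⟨T, hT, hTK⟩ : ∃ T : ℝ, 0 ≤ T ∧ ∀ θ ∈ K, ∀ l, |θ l| ≤ T := by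
    obtain ⟨T, hT⟩ := hK.isBounded.exists_norm_le
    exact ⟨|T|, abs_nonneg _, fun θ hθ l =>
      (norm_le_pi_norm θ l).trans ((hT θ hθ).trans (le_abs_self _))⟩
  obtain ⟨C, hC, hCK⟩ := exists_norm_sub_smul_L_le hp hK (fun θ hθ => (hKadm hθ).2) hT hTK
  set γ := δ / C with hγdef
  have hγ : 0 < γ := by positivity
  set G := B * (p * (p * T)) + 1 with hG
  have hG0 : 0 < G := by positivity
  -- With R = √(γh), this makes m (R/(2G))² at least hσ².
  set m := ⌈4 * G ^ 2 * σ ^ 2 / γ⌉₊ with hm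
  set c := 2 + 2 * (p * T ^ 2) with hc
  have hc0 : 0 < c := by positivity
  set D := 2 * c + 1 with hD
  have hD0 : 0 < D := by positivity
  -- Noise squares up to aDh then give |ε| ≤ η = R/(2(Bm + 1)), hence Bmη ≤ R/2.
  set a := γ / (4 * (B * m + 1) ^ 2 * D) with ha
  have ha0 : 0 < a := by positivity
  have hbad := tendsto_prob_noise_irregular hmeas hindep hident hL2 (by positivity) hvar ha0
  -- By time ⌈2ch⌉ a noise energy of σ²/2 per step adds up to chσ², enough for the trace to reach
  -- hσ² one step later.
  have hN : Tendsto (fun h : ℝ => ⌈2 * c * h⌉₊) atTop atTop :=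
    tendsto_nat_ceil_atTop.comp (tendsto_id.const_mul_atTop (by positivity))
  have hmart : Tendsto (fun h : ℝ => (p : ENNReal) *
      ENNReal.ofReal (σ ^ 2 * (h * σ ^ 2) / (γ * h) ^ 2)) atTop (𝓝 0) := by
    have h1 : Tendsto (fun h : ℝ => σ ^ 2 * (h * σ ^ 2) / (γ * h) ^ 2) atTop (𝓝 0) := by
      have h2 := (tendsto_inv_atTop_zero (𝕜 := ℝ)).const_mul (σ ^ 4 / γ ^ 2)
      rw [mul_zero] at h2
      refine h2.congr' ?_
      filter_upwards [eventually_gt_atTop 0] with h hh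
      field_simp
    have h3 := ENNReal.Tendsto.const_mul (a := (p : ENNReal)) (ENNReal.tendsto_ofReal h1)
      (Or.inr (ENNReal.natCast_ne_top p))
    simpa using h3
  have hsum := (hbad.comp hN).add hmart
  rw [add_zero] at hsum
  refine tendsto_of_tendsto_of_tendsto_of_le_of_le' tendsto_const_nhds hsum
    (Eventually.of_forall fun _ => zero_le) ?_
  filter_upwards [eventually_ge_atTop 1] with h hh
  refine iSup₂_le fun θ hθ => ?_
  have hh0 : 0 < h := by linarith
  have hA : 0 < h * σ ^ 2 := by positivity
  set N := ⌈2 * c * h⌉₊ with hNdef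
  have hNle : (N : ℝ) ≤ D * h := by
    have := (Nat.ceil_lt_add_one (by positivity : 0 ≤ 2 * c * h)).le
    rw [hD]; linarith
  have hNge : 2 * c * h ≤ N := Nat.le_ceil _
  have hsubset : {ω | tau θ (fun n => ε n ω) σ h = ⊤ ∨
      δ < ‖(1 / h) • M θ (fun n => ε n ω) (tau θ (fun n => ε n ω) σ h).toNat
                - (σ ^ 2 / (p : ℝ)) • L θ‖} ⊆
      {ω | ¬ (N * (σ ^ 2 / 2) ≤ ∑ i ∈ Finset.range N, ε i ω ^ 2 ∧
        ∀ i < N, ε i ω ^ 2 ≤ a * N)} ∪ ⋃ j : Fin p, {ω | γ * h <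
          |∑ k ∈ Finset.range N, ε k ω * stoppedState θ (h * σ ^ 2) j (fun n => ε n ω) k|} := by
    intro ω hω
    by_contra hcon
    simp only [Set.mem_union, Set.mem_iUnion, Set.mem_ofPred_eq, not_or, not_not, not_exists,
      not_lt] at hcon
    obtain ⟨⟨hsq, hmax⟩, hns⟩ := hcon
    set e : ℕ → ℝ := fun n => ε n ω with he
    have htr : h * σ ^ 2 ≤ (M θ e (N + 1)).trace := by
      have h1 := hsq.trans (sum_sq_noise_le hp (hTK θ hθ) e N)
      have h2 : c * (h * σ ^ 2) ≤ N * (σ ^ 2 / 2) := by nlinarith [sq_nonneg σ]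
      exact le_of_mul_le_mul_left (h2.trans h1) hc0
    obtain ⟨s, hsN, hτ, hlt, hle⟩ := exists_tau_eq_succ hA htr
    obtain ⟨Ψ, hΨ, hΨB⟩ := hBK θ hθ
    have hR : 0 < √(γ * h) := Real.sqrt_pos.2 (by positivity)
    have hRsq : √(γ * h) ^ 2 = γ * h := Real.sq_sqrt (by positivity)
    have hstate : ∀ i, |state θ e s i| ≤ √(γ * h) := by
      intro i
      refine abs_path_le_of_trace_lt (η := √(γ * h) / (2 * (B * m + 1))) (m := m) hΨ hΨB
        (hTK θ hθ) hT hG0 (by rw [hG]; linarith) hR hlt ?_ ?_ ?_ (Nat.sub_le _ _)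
      · intro i hi
        refine abs_le_of_sq_le_sq ?_ (by positivity)
        refine (hmax i (by omega)).trans ?_
        calc a * N ≤ a * (D * h) := by gcongr
          _ = _ := by
            rw [div_pow, hRsq, ha]
            field_simp
            ring
      · have : 0 < B * m + 1 := by positivity
        rw [← mul_assoc, mul_div_assoc', div_le_div_iff₀ (by positivity) (by norm_num)]
        nlinarith
      · rw [div_pow, hRsq]
        have h1 : 4 * G ^ 2 * σ ^ 2 / γ ≤ m := Nat.le_ceil _
        rw [div_le_iff₀ hγ] at h1
        rw [mul_div_assoc', le_div_iff₀ (by positivity)]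
        nlinarith
    have hfin := hCK θ hθ e s σ h γ hh0 hγ.le hlt hle hstate fun j => by
      rw [← sum_mul_stoppedState_eq j hsN hlt hle]
      exact hns j
    rw [hγdef, mul_div_cancel₀ _ hC.ne'] at hfin
    rcases hω with h1 | h1
    · rw [← he, hτ] at h1
      exact absurd h1 (ENat.natCast_ne_top _)
    · rw [← he, hτ, ENat.toNat_natCast] at h1
      exact absurd hfin (not_le.2 h1)
  refine (measure_mono hsubset).trans ((measure_union_le _ _).trans ?_)
  refine add_le_add le_rfl ((measure_iUnion_le _).trans ?_)
  rw [tsum_fintype]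
  calc _ ≤ ∑ _j : Fin p, ENNReal.ofReal (σ ^ 2 * (h * σ ^ 2) / (γ * h) ^ 2) := by
        refine Finset.sum_le_sum fun j _ => ?_
        refine prob_abs_sum_mul_gt_le hmeas hindep (fun n => (hident n).memLp_iff.2 hL2)
          (fun n => (hident n).integral_eq.trans hmean)
          (fun n => ((hident n).comp (u := fun x : ℝ => x ^ 2) (by fun_prop)).integral_eq.trans
            hvar)
          (ξ := fun k ω => stoppedState θ (h * σ ^ 2) j (fun n => ε n ω) k) (fun n => ?_)
          (fun N ω => sum_sq_stoppedState_le θ hA.le j _ N) (by positivity)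
        exact Measurable.ite (measurableSet_lt (measurable_past_trace_M θ ε n) measurable_const)
          (measurable_past_state θ ε le_rfl j) measurable_const
    _ = _ := by simp
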